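/- Let $a>0$ be a real number, let $k$ be a complex function that is analytic at every point of the interval $[0,a]$, let $\lambda\in\mathbb C\setminus\mathbb Z$ with $\operatorname{Re}\lambda\ge 1$, and let $n\ge 0$ be an integer. Conventions. In contour integrals, $\ln z=\ln|z|+i\arg z$ with $0\le\arg z<2\pi$ and $z^{-\lambda}=e^{-\lambda\ln z}$ (branch cut along $[0,\infty)$); for real $t>0$, $\ln t$ is the real logarithm and $t^{-\lambda}=e^{-\lambda\ln t}$. The finite part $\mathrm{f.p.}\!\int_0^a f(t)\,dt$ is the limit $\lim_{\epsilon\to0^+}\bigl(\int_\epsilon^a f(t)\,dt-D_\epsilon\bigr)$, where $D_\epsilon$ is a finite linear combination of functions $\epsilon^{\mu}\ln^m\epsilon$ ($\mu\in\mathbb C$, $m\in\mathbb Z_{\ge0}$) that have no finite limit as $\epsilon\to0^+$, i.e. with $\operatorname{Re}\mu\le0$ and $(\mu,m)\ne(0,0)$. It is unique if it exists. Let $C$ be any piecewise $C^1$ contour that begins and ends at $a$ and straddles the branch cut: it leaves $a$ into the upper half-plane, does not meet $[0,\infty)$ except at its two endpoints, and returns to $a$ from the lower half-plane. Assume that no singularity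 of $k$ (no point at which $k$ is not analytic) lies on $C$ or is enclosed by $C$, that is, $k$ is analytic at each point of $C$ and $C$ has winding number $0$ about each point at which $k$ is not analytic. Then the integrals $\int_C k(z)z^{-\lambda}\ln^j z\,dz$, $0\le j\le n$, converge absolutely, the finite part of $\int_0^a k(t)\,t^{-\lambda}\ln^n t\,dt$ exists, and $$\mathrm{f.p.}\!\int_0^a \frac{k(t)\ln^n t}{t^{\lambda}}\,dt=\sum_{j=0}^{n}\binom nj(2\pi i)^{n-j}\,\beta_j(\lambda)\int_C\frac{k(z)}{z^{\lambda}}\ln^j z\,dz,$$ where $$\beta_j(\lambda)=\sum_{l=0}^{n-j}(-1)^l\,l!\,S(n-j,l)\,\frac{e^{-2\pi i\lambda l}}{(e^{-2\pi i\lambda}-1)^{l+1}}$$ and $S(m,l)$ denotes the Stirling number of the second kind. -/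

import Mathlib

open Filter Topology Set
open scoped unitInterval

noncomputable section

namespace FinitePart

/-- The function `ε ↦ ε ^ μ * (ln ε) ^ m` of `ε > 0`. -/
def scale (μ : ℂ) (m : ℕ) : ℝ → ℂ :=
  fun ε => (ε : ℂ) ^ μ * (Real.log ε : ℂ) ^ m

/-- The possible divergent parts: finite linear combinations of those functions
`ε ^ μ * (ln ε) ^ m` that have no finite limit as `ε → 0+`, namely those with
`Re μ ≤ 0` and `(μ, m) ≠ (0, 0)`. For `Re μ = 0`, `μ ≠ 0` the function is oscillating. -/
def divergentTerms : Submodule ℂ (ℝ → ℂ) :=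
  Submodule.span ℂ {φ | ∃ (μ : ℂ) (m : ℕ), μ.re ≤ 0 ∧ (μ ≠ 0 ∨ m ≠ 0) ∧ φ = scale μ m}

/-- `HasFinitePartIntegral f a c` says that the finite part of the (in general divergent) integral
`∫_0^a f(t) dt` exists and equals `c`: for `0 < ε < a` the integral
`∫_ε^a f(t) dt` splits as `C ε + D ε`, with `D` a divergent part and `C ε → c` as `ε → 0+`. There is at most one such `c`
(`HasFinitePartIntegral.unique` below). -/
def HasFinitePartIntegral (f : ℝ → ℂ) (a : ℝ) (c : ℂ) : Prop :=
  (∀ ε ∈ Ioo 0 a, IntervalIntegrable f MeasureTheory.volume ε a) ∧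
    ∃ D ∈ divergentTerms,
      Tendsto (fun ε : ℝ => (∫ t in ε..a, f t) - D ε) (𝓝[>] 0) (𝓝 c)

/-- The argument of `z ≠ 0` in `[0, 2π)`. -/
def cutArg (z : ℂ) : ℝ :=
  if 0 ≤ z.arg then z.arg else z.arg + 2 * Real.pi

/-- The complex logarithm with `0 ≤ arg z < 2π`, its branch cut being `[0, ∞)`. -/
def cutLog (z : ℂ) : ℂ :=
  (Real.log ‖z‖ : ℂ) + (cutArg z : ℂ) * Complex.I

/-- The power `z ^ s` with branch cut `[0, ∞)`. -/
def cutPow (z s : ℂ) : ℂ :=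
  Complex.exp (s * cutLog z)

/-- The one-form `f(z) dz`. -/
def formDz (f : ℂ → ℂ) : ℂ → ℂ →L[ℂ] ℂ :=
  fun z => f z • ContinuousLinearMap.id ℂ ℂ

/-- The contour integral `∫_γ f(z) dz`. -/
def contourIntegral (f : ℂ → ℂ) {p q : ℂ} (γ : Path p q) : ℂ :=
  curveIntegral (formDz f) γ

/-- The contour integral `∫_γ f(z) dz` converges absolutely. -/
def ContourIntegrable (f : ℂ → ℂ) {p q : ℂ} (γ : Path p q) : Prop :=
  CurveIntegrable (formDz f) γ

/-- Piecewise continuously differentiable paths: there are finitely many break points, and the path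
is `C¹` (one-sidedly at the ends) on each closed interval without break points in its interior. -/
def IsPiecewiseC1 {p q : ℂ} (γ : Path p q) : Prop :=
  ∃ s : Finset ℝ, ∀ x y : ℝ, 0 ≤ x → x < y → y ≤ 1 → (∀ b ∈ s, b ∉ Ioo x y) →
    ContDiffOn ℝ 1 γ.extend (Icc x y)

/-- The winding number of a closed path around a point that is not on the path. -/
def windingNumber {p : ℂ} (γ : Path p p) (w : ℂ) : ℂ :=
  (2 * Real.pi * Complex.I)⁻¹ * contourIntegral (fun z => (z - w)⁻¹) γ

/-- The contours `C` for the function `k`: piecewise `C¹` loops that begin and end at the point `a`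
and straddle the branch cut `[0, ∞)` (leaving `a` on its upper side, otherwise not meeting it, and
returning to `a` on its lower side), such that no singularity of `k` (no point at which `k` fails
to be analytic) is on the loop or enclosed by it. -/
structure IsCutContour (k : ℂ → ℂ) (a : ℝ) (γ : Path (a : ℂ) (a : ℂ)) : Prop where
  piecewiseC1 : IsPiecewiseC1 γ
  avoids_cut : ∀ t ∈ Ioo (0 : ℝ) 1, ∀ x : ℝ, 0 ≤ x → γ.extend t ≠ (x : ℂ)
  starts_above : ∀ᶠ t in 𝓝[>] (0 : ℝ), 0 < (γ.extend t).im
  ends_below : ∀ᶠ t in 𝓝[<] (1 : ℝ), (γ.extend t).im < 0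
  analyticAt : ∀ t : I, AnalyticAt ℂ k (γ t)
  encloses_no_singularity : ∀ w : ℂ, ¬ AnalyticAt ℂ k w → windingNumber γ w = 0

/-- The coefficients `β_j(λ)`, for given `n`. -/
def beta (n j : ℕ) (lam : ℂ) : ℂ :=
  ∑ l ∈ Finset.range (n - j + 1),
    (-1) ^ l * (l.factorial : ℂ) * (Nat.stirlingSecond (n - j) l : ℂ) *
      (Complex.exp (-2 * Real.pi * Complex.I * lam * l) /
        (Complex.exp (-2 * Real.pi * Complex.I * lam) - 1) ^ (l + 1))

end FinitePart

namespace FinitePart.Uniqueness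

/-! Auxiliary facts showing that the finite part of an integral is unique: a divergent part cannot
have a nonzero limit. -/

/-- `scale` after the substitution `ε = exp (-x)`. -/
def expScale (ν : ℂ) (m : ℕ) : ℝ → ℂ := fun x => Complex.exp (ν * x) * (x : ℂ) ^ m

/-- Translation of functions by `h`. -/
def shift (h : ℝ) : Module.End ℂ (ℝ → ℂ) := LinearMap.funLeft ℂ ℂ (fun x => x + h)

/-- Dilation of functions by `2`. -/
def dil : Module.End ℂ (ℝ → ℂ) := LinearMap.funLeft ℂ ℂ (fun x => 2 * x)

/-- Operators that keep limits at infinity. -/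
def Keeps (L : Module.End ℂ (ℝ → ℂ)) : Prop :=
  ∀ g c, Tendsto g atTop (𝓝 c) → Tendsto (L g) atTop (𝓝 c)

theorem keeps_mul {L M} (hL : Keeps L) (hM : Keeps M) : Keeps (L * M) :=
  fun g c h => hL _ _ (hM g c h)

theorem keeps_affine {S : Module.End ℂ (ℝ → ℂ)} (hS : Keeps S) {r : ℂ} (hr : r ≠ 1) :
    Keeps ((1 - r)⁻¹ • (S - r • 1)) := by
  intro g c h
  have := ((hS g c h).sub (h.const_mul r)).const_mul (1 - r)⁻¹
  have e : (1 - r)⁻¹ * (c - r * c) = c := by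
    have : 1 - r ≠ 0 := sub_ne_zero.2 hr.symm
    field_simp
  rw [e] at this
  exact this

theorem keeps_shift (h : ℝ) : Keeps (shift h) :=
  fun _ _ hg => hg.comp (tendsto_atTop_add_const_right _ _ tendsto_id)

theorem keeps_dil : Keeps dil :=
  fun _ _ hg => hg.comp (tendsto_id.const_mul_atTop (by norm_num : (0:ℝ) < 2))

/-- The commutative algebra of shifts -/
abbrev ShiftAlg : Subalgebra ℂ (Module.End ℂ (ℝ → ℂ)) := Algebra.adjoin ℂ (range shift)

theorem shift_comm {L M} (hL : L ∈ ShiftAlg) (hM : M ∈ ShiftAlg) : L * M = M * L := by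
  have hc : ∀ a ∈ range shift, ∀ b ∈ range shift, a * b = b * a := by
    rintro _ ⟨h, rfl⟩ _ ⟨h', rfl⟩
    ext g x
    simp [shift, LinearMap.funLeft_apply, add_right_comm]
  have hi := Algebra.isMulCommutative_adjoin ℂ hc
  exact congrArg Subtype.val (hi.is_comm.comm (⟨L, hL⟩ : ShiftAlg) ⟨M, hM⟩)

/-- Functions annihilated by some limit-keeping combination of translations. -/
def Killed (g : ℝ → ℂ) : Prop := ∃ L ∈ ShiftAlg, Keeps L ∧ L g = 0

theorem killed_of_step {g : ℝ → ℂ} {L} (hL : L ∈ ShiftAlg) (hk : Keeps L) (h : Killed (L g)) :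
    Killed g := by
  obtain ⟨M, hM, hMk, h0⟩ := h
  exact ⟨M * L, mul_mem hM hL, keeps_mul hMk hk, h0⟩

theorem Killed.add {f g} (hf : Killed f) (hg : Killed g) : Killed (f + g) := by
  obtain ⟨L, hL, hLk, h0⟩ := hf
  obtain ⟨M, hM, hMk, h1⟩ := hg
  refine ⟨L * M, mul_mem hL hM, keeps_mul hLk hMk, ?_⟩
  rw [map_add]
  nth_rw 1 [shift_comm hL hM]
  simp [h0, h1]

theorem Killed.smul {f} (c : ℂ) (hf : Killed f) : Killed (c • f) := by
  obtain ⟨L, hL, hLk, h0⟩ := hf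
  exact ⟨L, hL, hLk, by simp [h0]⟩

theorem Killed.zero : Killed 0 := ⟨1, one_mem _, fun _ _ h => h, rfl⟩

theorem Killed.sum {ι : Type} (s : Finset ι) (f : ι → ℝ → ℂ) (h : ∀ i ∈ s, Killed (f i)) :
    Killed (∑ i ∈ s, f i) := by
  classical
  exact Finset.sum_induction f Killed (fun _ _ => Killed.add) Killed.zero h

theorem exp_step {ν : ℂ} (hν : ν ≠ 0) : ∃ h : ℝ, Complex.exp (ν * h) ≠ 1 := by
  refine ⟨‖ν‖⁻¹, fun H => ?_⟩
  obtain ⟨n, hn⟩ := Complex.exp_eq_one_iff.1 H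
  have h1 : ‖ν * ((‖ν‖⁻¹ : ℝ) : ℂ)‖ = 1 := by
    have : ‖ν‖ ≠ 0 := norm_ne_zero_iff.2 hν
    simp [this]
  rw [hn] at h1
  simp only [norm_mul, Complex.norm_intCast, Complex.norm_I, Complex.norm_real, Complex.norm_ofNat,
    mul_one, Real.norm_eq_abs, abs_of_pos Real.pi_pos] at h1
  rcases eq_or_ne n 0 with rfl | h0
  · simp at h1
  · have : (1:ℝ) ≤ |(n:ℝ)| := by exact_mod_cast Int.one_le_abs h0
    nlinarith [Real.pi_gt_three]

theorem killed_expScale {ν : ℂ} (hν : ν ≠ 0) (m : ℕ) : Killed (expScale ν m) := by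
  obtain ⟨h, hh⟩ := exp_step hν
  induction m using Nat.strong_induction_on with
  | _ m ih =>
    refine killed_of_step (L := (1 - Complex.exp (ν * h))⁻¹ • (shift h - Complex.exp (ν * h) • 1))
      ?_ (keeps_affine (keeps_shift h) hh) ?_
    · exact Subalgebra.smul_mem _ (sub_mem (Algebra.subset_adjoin (mem_range_self h))
        (Subalgebra.smul_mem _ (one_mem _) _)) _
    · have : ((1 - Complex.exp (ν * h))⁻¹ • (shift h - Complex.exp (ν * h) • 1)) (expScale ν m)
          = ∑ i ∈ Finset.range m, ((1 - Complex.exp (ν * h))⁻¹ * Complex.exp (ν * h) *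
              ((h : ℂ) ^ (m - i) * m.choose i)) • expScale ν i := by
        ext x
        simp only [LinearMap.smul_apply, LinearMap.sub_apply, Module.End.one_apply, Pi.smul_apply,
          Pi.sub_apply, smul_eq_mul, Finset.sum_apply, shift, LinearMap.funLeft_apply, expScale]
        push_cast
        rw [add_pow, Finset.sum_range_succ, mul_add ν, Complex.exp_add]
        simp only [Nat.sub_self, pow_zero, Nat.choose_self, Nat.cast_one, mul_one]
        rw [mul_add, mul_comm (Complex.exp (ν * x)) (Complex.exp (ν * h)), mul_assoc _ _ ((x:ℂ) ^ m),
          add_sub_cancel_right, Finset.mul_sum, Finset.mul_sum]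
        refine Finset.sum_congr rfl fun i _ => by ring
      rw [this]
      exact Killed.sum _ _ fun i hi => (ih i (Finset.mem_range.1 hi)).smul _

/-- The span of the exponential terms with nonzero exponent. -/
def W : Submodule ℂ (ℝ → ℂ) := Submodule.span ℂ {φ | ∃ ν m, ν ≠ 0 ∧ φ = expScale ν m}

theorem killed_of_mem_W {g} (hg : g ∈ W) : Killed g := by
  induction hg using Submodule.span_induction with
  | mem x h => obtain ⟨ν, m, hν, rfl⟩ := h; exact killed_expScale hν m
  | zero => exact Killed.zero
  | add _ _ _ _ h h' => exact h.add h'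
  | smul c _ _ h => exact h.smul c

theorem dil_expScale (ν : ℂ) (m : ℕ) : dil (expScale ν m) = (2 : ℂ) ^ m • expScale (2 * ν) m := by
  ext x
  simp only [dil, LinearMap.funLeft_apply, expScale, Pi.smul_apply, smul_eq_mul]
  push_cast
  rw [mul_pow, show ν * (2 * (x : ℂ)) = 2 * ν * x by ring]
  ring

theorem dil_W {g} (hg : g ∈ W) : dil g ∈ W := by
  induction hg using Submodule.span_induction with
  | mem x h =>
    obtain ⟨ν, m, hν, rfl⟩ := h
    rw [dil_expScale]
    exact W.smul_mem _ (Submodule.subset_span ⟨2 * ν, m, by simp [hν], rfl⟩)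
  | zero => simp
  | add _ _ _ _ h h' => rw [map_add]; exact W.add_mem h h'
  | smul c _ _ h => rw [map_smul]; exact W.smul_mem c h

/-- Polynomials in `dil` that keep limits and `W`. -/
def Good (p : Polynomial ℂ) : Prop :=
  Keeps (Polynomial.aeval dil p) ∧ ∀ g ∈ W, Polynomial.aeval dil p g ∈ W

theorem Good.mul {p q} (hp : Good p) (hq : Good q) : Good (p * q) := by
  constructor
  · rw [map_mul]; exact keeps_mul hp.1 hq.1
  · intro g hg; rw [map_mul]; exact hp.2 _ (hq.2 g hg)

theorem exists_dil {g : ℝ → ℂ}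
    (hg : g ∈ Submodule.span ℂ {φ | ∃ (ν : ℂ) (m : ℕ), (ν ≠ 0 ∨ m ≠ 0) ∧ φ = expScale ν m}) :
    ∃ p, Good p ∧ Polynomial.aeval dil p g ∈ W := by
  have good1 : Good 1 := ⟨by rw [map_one]; exact fun _ _ h => h, by simp⟩
  induction hg using Submodule.span_induction with
  | mem x h =>
    obtain ⟨ν, m, h, rfl⟩ := h
    by_cases hν : ν = 0
    · subst hν
      have hm : m ≠ 0 := by simpa using h
      have h2 : (2 : ℂ) ^ m ≠ 1 := by
        have : 1 < 2 ^ m := Nat.one_lt_two_pow hm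
        exact_mod_cast this.ne'
      have e : Polynomial.aeval dil (Polynomial.C (1 - (2:ℂ) ^ m)⁻¹ *
          (Polynomial.X - Polynomial.C ((2:ℂ) ^ m))) = (1 - (2:ℂ) ^ m)⁻¹ • (dil - (2:ℂ) ^ m • 1) := by
        rw [map_mul, map_sub, Polynomial.aeval_C, Polynomial.aeval_C, Polynomial.aeval_X,
          Algebra.algebraMap_eq_smul_one, Algebra.algebraMap_eq_smul_one, smul_one_mul]
      refine ⟨Polynomial.C (1 - (2:ℂ) ^ m)⁻¹ * (Polynomial.X - Polynomial.C ((2:ℂ) ^ m)), ⟨?_, ?_⟩, ?_⟩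
      · rw [e]; exact keeps_affine keeps_dil h2
      · intro g hg
        rw [e]
        exact W.smul_mem _ (W.sub_mem (dil_W hg) (W.smul_mem _ hg))
      · rw [e]
        simp [dil_expScale]
    · exact ⟨1, good1, by rw [map_one]; exact Submodule.subset_span ⟨ν, m, hν, rfl⟩⟩
  | zero => exact ⟨1, good1, by simp⟩
  | add f g _ _ h h' =>
    obtain ⟨p, hp, hf⟩ := h
    obtain ⟨q, hq, hg⟩ := h'
    refine ⟨p * q, hp.mul hq, ?_⟩
    rw [map_add]
    refine W.add_mem ?_ ?_
    · rw [mul_comm, map_mul]; exact hq.2 _ hf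
    · rw [map_mul]; exact hp.2 _ hg
  | smul c f _ h =>
    obtain ⟨p, hp, hf⟩ := h
    exact ⟨p, hp, by rw [map_smul]; exact W.smul_mem _ hf⟩

theorem limit_eq_zero {D : ℝ → ℂ} (hD : D ∈ divergentTerms) {c : ℂ}
    (h : Tendsto D (𝓝[>] 0) (𝓝 c)) : c = 0 := by
  have hm : LinearMap.funLeft ℂ ℂ (fun x : ℝ => Real.exp (-x)) D ∈
      Submodule.span ℂ {φ | ∃ (ν : ℂ) (m : ℕ), (ν ≠ 0 ∨ m ≠ 0) ∧ φ = expScale ν m} := by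
    clear h
    induction hD using Submodule.span_induction with
    | mem x h =>
      obtain ⟨μ, m, -, h, rfl⟩ := h
      have : LinearMap.funLeft ℂ ℂ (fun x : ℝ => Real.exp (-x)) (scale μ m) =
          (-1 : ℂ) ^ m • expScale (-μ) m := by
        ext x
        have h1 : ((Real.exp (-x) : ℝ) : ℂ) ≠ 0 := by exact_mod_cast (Real.exp_pos _).ne'
        simp only [LinearMap.funLeft_apply, scale, expScale, Pi.smul_apply, smul_eq_mul,
          Real.log_exp]
        rw [Complex.cpow_def_of_ne_zero h1, ← Complex.ofReal_log (Real.exp_pos _).le, Real.log_exp]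
        push_cast
        rw [neg_pow, show -(x : ℂ) * μ = -μ * x by ring]
        ring
      rw [this]
      exact Submodule.smul_mem _ _ (Submodule.subset_span ⟨-μ, m, by simpa using h, rfl⟩)
    | zero => simp
    | add _ _ _ _ h h' => rw [map_add]; exact Submodule.add_mem _ h h'
    | smul c _ _ h => rw [map_smul]; exact Submodule.smul_mem _ c h
  have ht : Tendsto (fun x : ℝ => Real.exp (-x)) atTop (𝓝[>] 0) :=
    tendsto_nhdsWithin_iff.2 ⟨Real.tendsto_exp_neg_atTop_nhds_zero,
      Eventually.of_forall fun x => Real.exp_pos _⟩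
  obtain ⟨p, hp, hW⟩ := exists_dil hm
  obtain ⟨L, -, hL, h0⟩ := killed_of_mem_W hW
  have hc : Tendsto (LinearMap.funLeft ℂ ℂ (fun x : ℝ => Real.exp (-x)) D) atTop (𝓝 c) :=
    h.comp ht
  have := hL _ _ (hp.1 _ _ hc)
  rw [h0] at this
  exact tendsto_nhds_unique this tendsto_const_nhds

end FinitePart.Uniqueness

namespace FinitePart

/-- The finite part of an integral is unique. -/
theorem HasFinitePartIntegral.unique {f : ℝ → ℂ} {a : ℝ} {c c' : ℂ}
    (h : HasFinitePartIntegral f a c) (h' : HasFinitePartIntegral f a c') : c = c' := by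
  obtain ⟨-, D, hD, h⟩ := h
  obtain ⟨-, D', hD', h'⟩ := h'
  have := Uniqueness.limit_eq_zero (divergentTerms.sub_mem hD' hD)
    ((h.sub h').congr fun x => by simp)
  exact sub_eq_zero.1 this

end FinitePart

end

/-!
The divergent integral over `[0, a]` and the contour integrals are evaluated by the same primitives.
Put `ν = 1 - λ`, which is not an integer. On a convex neighbourhood `Ω` of `[0, a]` where `k` is
holomorphic, the equations `ν A₀ + z A₀' = k` and `ν Aₘ₊₁ + z Aₘ₊₁' = -(m + 1) Aₘ` have holomorphic
solutions (`exists_euler_seq`), and `G_j = z ^ ν ∑ i, (j choose i) A_{j-i}(z) ln ^ i z` is a primitive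
of `k(z) z ^ (-λ) ln ^ j z` (`hasDerivAt_logPrimitive`). As `ε → 0+`, `G_n(ε)` is a divergent part up
to a null function, because no exponent `ν + m` vanishes, so the finite part is the value `T_n` of
`G_n` at `a` (`hasFinitePartIntegral_logPrimitive`). A contour inside `Ω` that goes once around the
cut gives instead the jump `J_j` of `G_j`, as `ln z` increases by `2πi` along it. In terms of
exponential generating functions `J(x) = (q exp (2πi x) - 1) T(x)` with `q = exp (-2πiλ)`
(`egf_logPrimitive_sub`), and the `β_j` are the Taylor coefficients of `1 / (q exp x - 1)`, expanded
as a geometric series in `exp x - 1` (`sum_choose_mul_invExpCoeff`).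

The given contour may leave `Ω`, wind around itself and surround holes of the domain of `k`. It is
compared with a thin ellipse in `Ω` by a version of Cauchy's theorem that only assumes vanishing
winding numbers, `integral_eq_integral_of_winding_eq_zero`. Its proof is Dixon's: the difference of the
two integrals of `(k(z) - k(w)) / (z - w) * ψ(ln z)` extends to an entire function of `w` that
vanishes at infinity. The multivalued `ψ(ln z) = z ^ (-λ) ln ^ j z` enters through the single fact that
`ψ(ln z) / (z - w)` has the same integral along both contours when neither winds around `w`
(`integral_kernel_eq`). The cut causes no trouble since all integrals are pulled back to the
continuous logarithm `logLift`, which runs from `ln a` to `ln a + 2πi` for each of the contours.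
-/

namespace FinitePart

/-! ### Loops straddling the cut and the logarithm along them -/

/-- A loop `c : [0, 1] → ℂ` at `a`, continuous, leaving `a` into the upper half-plane, avoiding
`[0, ∞)` on `(0, 1)` and returning to `a` from the lower half-plane, together with an integrable
function `D` which is its derivative off a countable set. Along such a loop
`∫ t in 0..1, f (c t) * D t` is the contour integral of `f`. -/
structure CutLoop (a : ℝ) (c D : ℝ → ℂ) : Prop where
  pos : 0 < a
  continuousOn : ContinuousOn c (Icc 0 1)
  map_zero : c 0 = a
  map_one : c 1 = a
  neg_mem_slitPlane : ∀ t ∈ Ioo (0 : ℝ) 1, -c t ∈ Complex.slitPlane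
  starts_above : ∀ᶠ t in 𝓝[>] (0 : ℝ), 0 < (c t).im
  ends_below : ∀ᶠ t in 𝓝[<] (1 : ℝ), (c t).im < 0
  intervalIntegrable : IntervalIntegrable D MeasureTheory.volume 0 1
  hasDerivAt : ∃ s : Set ℝ, s.Countable ∧ ∀ t ∈ Ioo (0 : ℝ) 1 \ s, HasDerivAt c (D t) t

/-- The continuous logarithm along a loop `c` at `a` around the cut: it goes from `ln a` to
`ln a + 2πi`, and for `0 < t < 1` it is the branch of the logarithm of `c t` with imaginary part
in `(0, 2π)`, written as `log (-z) + πi`. -/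
noncomputable def logLift (a : ℝ) (c : ℝ → ℂ) (t : ℝ) : ℂ :=
  if t ≤ 0 then Real.log a else if 1 ≤ t then Real.log a + 2 * Real.pi * Complex.I
    else Complex.log (-c t) + Real.pi * Complex.I

theorem log_neg_of_im_pos {z : ℂ} (hz : 0 < z.im) :
    Complex.log (-z) + Real.pi * Complex.I = Complex.log z := by
  rw [Complex.log, Complex.log, Complex.arg_neg_eq_arg_sub_pi_of_im_pos hz, norm_neg]
  push_cast; ring

theorem log_neg_of_im_neg {z : ℂ} (hz : z.im < 0) :
    Complex.log (-z) + Real.pi * Complex.I = Complex.log z + 2 * Real.pi * Complex.I := by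
  rw [Complex.log, Complex.log, Complex.arg_neg_eq_arg_add_pi_of_im_neg hz, norm_neg]
  push_cast; ring

section

variable {a : ℝ} {c D : ℝ → ℂ}

theorem logLift_zero : logLift a c 0 = Real.log a := by simp [logLift]

theorem logLift_one : logLift a c 1 = Real.log a + 2 * Real.pi * Complex.I := by
  simp [logLift]

theorem logLift_of_mem {t : ℝ} (ht : t ∈ Ioo (0 : ℝ) 1) :
    logLift a c t = Complex.log (-c t) + Real.pi * Complex.I := by
  simp [logLift, not_le.2 ht.1, not_le.2 ht.2]

theorem im_logLift_mem (t : ℝ) : (logLift a c t).im ∈ Icc 0 (2 * Real.pi) := by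
  have hp := Real.pi_pos
  unfold logLift
  split_ifs
  · simp [hp.le]
  · simp [hp.le]
  · have h1 := Complex.neg_pi_lt_arg (-c t)
    have h2 := Complex.arg_le_pi (-c t)
    simp only [Complex.add_im, Complex.log_im, Complex.mul_im, Complex.ofReal_re, Complex.I_im,
      Complex.ofReal_im, Complex.I_re, mul_one, mul_zero, add_zero]
    constructor <;> linarith

namespace CutLoop

theorem ne_zero (h : CutLoop a c D) {t : ℝ} (ht : t ∈ Icc (0 : ℝ) 1) : c t ≠ 0 := by
  rcases eq_or_lt_of_le ht.1 with rfl | h0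
  · rw [h.map_zero]; exact_mod_cast h.pos.ne'
  rcases eq_or_lt_of_le ht.2 with rfl | h1
  · rw [h.map_one]; exact_mod_cast h.pos.ne'
  · exact neg_ne_zero.1 (Complex.slitPlane_ne_zero (h.neg_mem_slitPlane t ⟨h0, h1⟩))

theorem exp_logLift (h : CutLoop a c D) {t : ℝ} (ht : t ∈ Icc (0 : ℝ) 1) :
    Complex.exp (logLift a c t) = c t := by
  have e : Complex.exp (Real.log a) = a := by
    rw [← Complex.ofReal_exp, Real.exp_log h.pos]
  rcases eq_or_lt_of_le ht.1 with rfl | h0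
  · rw [logLift_zero, h.map_zero, e]
  rcases eq_or_lt_of_le ht.2 with rfl | h1
  · rw [logLift_one, h.map_one, Complex.exp_add, e, Complex.exp_two_pi_mul_I, mul_one]
  · rw [logLift_of_mem ⟨h0, h1⟩, Complex.exp_add, Complex.exp_log (neg_ne_zero.2 (h.ne_zero ht)),
      Complex.exp_pi_mul_I]
    ring

theorem continuousOn_logLift (h : CutLoop a c D) : ContinuousOn (logLift a c) (Icc 0 1) := by
  have ha : (a : ℂ) ∈ Complex.slitPlane := Complex.ofReal_mem_slitPlane.2 h.pos
  intro t ht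
  rcases eq_or_lt_of_le ht.1 with rfl | h0
  · refine ContinuousWithinAt.mono_of_mem_nhdsWithin (t := Ici 0) ?_
      (mem_of_superset self_mem_nhdsWithin fun x hx => hx.1)
    rw [← Ioi_insert, continuousWithinAt_insert_self]
    have hc : ContinuousWithinAt c (Ioi 0) 0 :=
      (h.continuousOn 0 ht).mono_of_mem_nhdsWithin
        (mem_of_superset (Ioo_mem_nhdsGT one_pos) Ioo_subset_Icc_self)
    rw [ContinuousWithinAt, h.map_zero] at hc
    rw [ContinuousWithinAt, logLift_zero, Complex.ofReal_log h.pos.le]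
    refine ((continuousAt_clog ha).tendsto.comp hc).congr' ?_
    filter_upwards [h.starts_above, Ioo_mem_nhdsGT one_pos] with t h1 h2
    rw [logLift_of_mem h2, log_neg_of_im_pos h1, Function.comp]
  rcases eq_or_lt_of_le ht.2 with rfl | h1
  · refine ContinuousWithinAt.mono_of_mem_nhdsWithin (t := Iic 1) ?_
      (mem_of_superset self_mem_nhdsWithin fun x hx => hx.2)
    rw [← Iio_insert, continuousWithinAt_insert_self]
    have hc : ContinuousWithinAt c (Iio 1) 1 :=
      (h.continuousOn 1 ht).mono_of_mem_nhdsWithin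
        (mem_of_superset (Ioo_mem_nhdsLT one_pos) Ioo_subset_Icc_self)
    rw [ContinuousWithinAt, h.map_one] at hc
    rw [ContinuousWithinAt, logLift_one, Complex.ofReal_log h.pos.le]
    refine (((continuousAt_clog ha).tendsto.comp hc).add_const _).congr' ?_
    filter_upwards [h.ends_below, Ioo_mem_nhdsLT one_pos] with t h1 h2
    rw [logLift_of_mem h2, log_neg_of_im_neg h1, Function.comp]
  · have hc : ContinuousAt c t := h.continuousOn.continuousAt (Icc_mem_nhds h0 h1)
    refine ContinuousAt.continuousWithinAt ?_
    refine ContinuousAt.congr (f := fun t => Complex.log (-c t) + Real.pi * Complex.I) ?_ ?_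
    · exact (hc.neg.clog (h.neg_mem_slitPlane t ⟨h0, h1⟩)).add continuousAt_const
    · filter_upwards [Ioo_mem_nhds h0 h1] with x hx using (logLift_of_mem hx).symm

/-- The logarithm along the loop has derivative `c' / c`. -/
theorem hasDerivAt_logLift (h : CutLoop a c D) {t : ℝ} (ht : t ∈ Ioo (0 : ℝ) 1)
    (hd : HasDerivAt c (D t) t) : HasDerivAt (logLift a c) (D t / c t) t := by
  have h1 := (hd.neg.clog_real (h.neg_mem_slitPlane t ht)).add_const (Real.pi * Complex.I)
  rw [show D t / c t = -D t / (-c) t by simp [neg_div_neg_eq]]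
  refine h1.congr_of_eventuallyEq ?_
  filter_upwards [Ioo_mem_nhds ht.1 ht.2] with x hx using logLift_of_mem hx

theorem intervalIntegrable_mul (h : CutLoop a c D) {f : ℝ → ℂ} (hf : ContinuousOn f (Icc 0 1)) :
    IntervalIntegrable (fun t => f t * D t) MeasureTheory.volume 0 1 :=
  h.intervalIntegrable.continuousOn_mul (by rwa [uIcc_of_le zero_le_one])

theorem integral_logLift (h : CutLoop a c D) {G g : ℂ → ℂ}
    (hG : ∀ t ∈ Icc (0 : ℝ) 1, HasDerivAt G (g (logLift a c t)) (logLift a c t))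
    (hg : ∀ t ∈ Icc (0 : ℝ) 1, ContinuousAt g (logLift a c t)) :
    ∫ t in (0 : ℝ)..1, (g (logLift a c t) / c t) * D t =
      G (Real.log a + 2 * Real.pi * Complex.I) - G (Real.log a) := by
  obtain ⟨s, hs, hd⟩ := h.hasDerivAt
  rw [← logLift_one (a := a) (c := c), ← logLift_zero (a := a) (c := c)]
  refine MeasureTheory.integral_eq_of_hasDerivAt_off_countable_of_le
    (fun t => G (logLift a c t)) _ zero_le_one hs ?_ ?_ ?_
  · intro t ht
    exact (hG t ht).continuousAt.comp_continuousWithinAt (h.continuousOn_logLift t ht)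
  · intro t ht
    have := (hG t (Ioo_subset_Icc_self ht.1)).comp t (h.hasDerivAt_logLift ht.1 (hd t ht))
    rwa [mul_div_assoc', ← div_mul_eq_mul_div] at this
  · refine h.intervalIntegrable_mul fun t ht => ?_
    exact ((hg t ht).comp_continuousWithinAt (h.continuousOn_logLift t ht)).div
      (h.continuousOn t ht) (h.ne_zero ht)

theorem integral_eq_zero (h : CutLoop a c D) {G g : ℂ → ℂ}
    (hG : ∀ t ∈ Icc (0 : ℝ) 1, HasDerivAt G (g (c t)) (c t))
    (hg : ∀ t ∈ Icc (0 : ℝ) 1, ContinuousAt g (c t)) :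
    ∫ t in (0 : ℝ)..1, g (c t) * D t = 0 := by
  obtain ⟨s, hs, hd⟩ := h.hasDerivAt
  have : (0 : ℂ) = G (c 1) - G (c 0) := by rw [h.map_zero, h.map_one, sub_self]
  rw [this]
  refine MeasureTheory.integral_eq_of_hasDerivAt_off_countable_of_le
    (fun t => G (c t)) _ zero_le_one hs ?_ ?_ ?_
  · intro t ht
    exact (hG t ht).continuousAt.comp_continuousWithinAt (h.continuousOn t ht)
  · intro t ht
    exact (hG t (Ioo_subset_Icc_self ht.1)).comp t (hd t ht)
  · exact h.intervalIntegrable_mul fun t ht =>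
      (hg t ht).comp_continuousWithinAt (h.continuousOn t ht)

end CutLoop

end

/-! ### Holomorphic dependence of integrals on a parameter -/

/-- Differentiation under the integral sign for a locally bounded family of holomorphic functions
against an integrable weight; the derivatives are dominated by the Cauchy estimate. -/
theorem hasDerivAt_integral_mul {U : Set ℂ} (hU : IsOpen U) {F : ℂ → ℝ → ℂ} {m : ℝ → ℂ}
    (hm : IntervalIntegrable m MeasureTheory.volume 0 1)
    (hc : ∀ w ∈ U, ContinuousOn (F w) (Icc 0 1))
    (hd : ∀ t ∈ Icc (0 : ℝ) 1, DifferentiableOn ℂ (fun w => F w t) U)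
    (hb : ∀ w₀ ∈ U, ∃ r > 0, ∃ B : ℝ, ∀ w ∈ Metric.ball w₀ r, ∀ t ∈ Icc (0 : ℝ) 1, ‖F w t‖ ≤ B)
    {w₀ : ℂ} (hw₀ : w₀ ∈ U) :
    HasDerivAt (fun w => ∫ t in (0 : ℝ)..1, F w t * m t)
      (∫ t in (0 : ℝ)..1, deriv (fun w => F w t) w₀ * m t) w₀ := by
  obtain ⟨r₁, hr₁, B, hB⟩ := hb w₀ hw₀
  obtain ⟨r₂, hr₂, hr₂U⟩ := Metric.isOpen_iff.1 hU w₀ hw₀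
  set r := min r₁ r₂ with hr
  have hr0 : 0 < r := lt_min hr₁ hr₂
  have hrU : Metric.ball w₀ r ⊆ U := (Metric.ball_subset_ball (min_le_right _ _)).trans hr₂U
  replace hB : ∀ w ∈ Metric.ball w₀ r, ∀ t ∈ Icc (0 : ℝ) 1, ‖F w t‖ ≤ B := fun w hw =>
    hB w (Metric.ball_subset_ball (min_le_left _ _) hw)
  simp only [intervalIntegral.integral_of_le zero_le_one]
  set μ := MeasureTheory.volume.restrict (Ioc (0 : ℝ) 1) with hμ
  have hmi : MeasureTheory.Integrable m μ :=
    (intervalIntegrable_iff_integrableOn_Ioc_of_le zero_le_one).1 hm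
  have hmem : ∀ᵐ t ∂μ, t ∈ Icc (0 : ℝ) 1 :=
    (MeasureTheory.ae_restrict_mem measurableSet_Ioc).mono fun t ht => Ioc_subset_Icc_self ht
  have hFm : ∀ w ∈ U, MeasureTheory.AEStronglyMeasurable (F w) μ := fun w hw =>
    ((hc w hw).mono Ioc_subset_Icc_self).aestronglyMeasurable measurableSet_Ioc
  have hda : ∀ t ∈ Icc (0 : ℝ) 1, ∀ w ∈ U, HasDerivAt (fun w => F w t)
      (deriv (fun w => F w t) w) w := fun t ht w hw =>
    ((hd t ht).differentiableAt (hU.mem_nhds hw)).hasDerivAt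
  have hbd : ∀ t ∈ Icc (0 : ℝ) 1, ∀ w ∈ Metric.ball w₀ (r / 2),
      ‖deriv (fun w => F w t) w‖ ≤ B / (r / 4) := by
    intro t ht w hw
    have hsub : Metric.closedBall w (r / 4) ⊆ Metric.ball w₀ r := by
      intro z hz
      rw [Metric.mem_closedBall] at hz
      rw [Metric.mem_ball] at hw ⊢
      linarith [dist_triangle z w w₀]
    refine Complex.norm_deriv_le_of_forall_mem_sphere_norm_le (by positivity) ?_ ?_
    · refine DifferentiableOn.diffContOnCl ?_
      exact (hd t ht).mono ((Metric.closure_ball_subset_closedBall.trans hsub).trans hrU)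
    · intro z hz
      exact hB z (hsub (Metric.sphere_subset_closedBall hz)) t ht
  refine (hasDerivAt_integral_of_dominated_loc_of_deriv_le (μ := μ)
    (F := fun w t => F w t * m t) (F' := fun w t => deriv (fun w => F w t) w * m t)
    (bound := fun t => B / (r / 4) * ‖m t‖) (s := Metric.ball w₀ (r / 2))
    (Metric.ball_mem_nhds _ (by positivity)) ?_ ?_ ?_ ?_ ?_ ?_).2
  · filter_upwards [hU.mem_nhds hw₀] with w hw
    exact (hFm w hw).mul hmi.aestronglyMeasurable
  · refine hmi.bdd_mul (hFm w₀ hw₀) (c := B) ?_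
    filter_upwards [hmem] with t ht using hB w₀ (Metric.mem_ball_self hr0) t ht
  · refine MeasureTheory.AEStronglyMeasurable.mul ?_ hmi.aestronglyMeasurable
    -- the derivative at `w₀` is a limit of a sequence of difference quotients
    set ε : ℕ → ℂ := fun n => w₀ + ((r / 2 * (1 / ((n : ℝ) + 1)) : ℝ) : ℂ) with hε
    have hpos : ∀ n : ℕ, 0 < r / 2 * (1 / ((n : ℝ) + 1)) := fun n => by positivity
    have hεU : ∀ n, ε n ∈ U := by
      intro n
      refine hrU ?_
      have h1 : 1 / ((n : ℝ) + 1) ≤ 1 := by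
        rw [div_le_one (by positivity)]; linarith [n.cast_nonneg (α := ℝ)]
      rw [Metric.mem_ball, dist_eq_norm, hε]
      simp only [add_sub_cancel_left, Complex.norm_real, Real.norm_eq_abs, abs_of_pos (hpos n)]
      nlinarith
    have hlim : Tendsto ε atTop (𝓝[≠] w₀) := by
      refine tendsto_nhdsWithin_iff.2 ⟨?_, Eventually.of_forall fun n => ?_⟩
      · have h1 := (tendsto_one_div_add_atTop_nhds_zero_nat (𝕜 := ℝ)).const_mul (r / 2)
        have h2 := (Complex.continuous_ofReal.tendsto _).comp h1
        have h3 := h2.const_add w₀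
        simpa [hε] using h3
      · have : ((r / 2 * (1 / ((n : ℝ) + 1)) : ℝ) : ℂ) ≠ 0 := by exact_mod_cast (hpos n).ne'
        simpa [hε] using this
    refine aestronglyMeasurable_of_tendsto_ae atTop
      (f := fun n t => (ε n - w₀)⁻¹ * (F (ε n) t - F w₀ t)) ?_ ?_
    · intro n
      exact ((hFm _ (hεU n)).sub (hFm _ hw₀)).const_mul _
    · filter_upwards [hmem] with t ht
      exact (hda t ht w₀ hw₀).tendsto_slope.comp hlim
  · filter_upwards [hmem] with t ht w hw
    rw [norm_mul]
    exact mul_le_mul_of_nonneg_right (hbd t ht w hw) (norm_nonneg _)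
  · exact hmi.norm.const_mul _
  · filter_upwards [hmem] with t ht w hw
    exact (hda t ht w (hrU (Metric.ball_subset_ball (by linarith) hw))).mul_const _

/-- Joint continuity gives the local bound needed to differentiate under the integral sign. -/
theorem exists_ball_bound {U : Set ℂ} (hU : IsOpen U) {F : ℂ → ℝ → ℂ}
    (hF : ContinuousOn (fun p : ℂ × ℝ => F p.1 p.2) (U ×ˢ Icc 0 1)) {w₀ : ℂ} (hw₀ : w₀ ∈ U) :
    ∃ r > 0, ∃ B : ℝ, ∀ w ∈ Metric.ball w₀ r, ∀ t ∈ Icc (0 : ℝ) 1, ‖F w t‖ ≤ B := by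
  obtain ⟨r, hr, hrU⟩ := Metric.nhds_basis_closedBall.mem_iff.1 (hU.mem_nhds hw₀)
  obtain ⟨B, hB⟩ := ((isCompact_closedBall w₀ r).prod (isCompact_Icc (a := (0 : ℝ)) (b := 1))
    ).exists_bound_of_continuousOn (hF.mono (prod_mono_left hrU))
  exact ⟨r, hr, B, fun w hw t ht => hB (w, t) ⟨Metric.ball_subset_closedBall hw, ht⟩⟩

/-- The difference quotients of a holomorphic function are bounded, locally in one variable and on
a compact set in the other one. -/
theorem exists_ball_bound_dslope {U : Set ℂ} (hU : IsOpen U) {k : ℂ → ℂ}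
    (hk : DifferentiableOn ℂ k U) {K : Set ℂ} (hK : IsCompact K) (hKU : K ⊆ U)
    {w₀ : ℂ} (hw₀ : w₀ ∈ U) :
    ∃ r > 0, ∃ B : ℝ, ∀ w ∈ Metric.ball w₀ r, ∀ z ∈ K, ‖dslope k w z‖ ≤ B := by
  obtain ⟨R, hR, hRU⟩ := Metric.nhds_basis_closedBall.mem_iff.1 (hU.mem_nhds hw₀)
  obtain ⟨B₁, hB₁⟩ := ((isCompact_closedBall w₀ R).union hK).exists_bound_of_continuousOn
    (hk.continuousOn.mono (union_subset hRU hKU))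
  obtain ⟨B₂, hB₂⟩ := (isCompact_closedBall w₀ R).exists_bound_of_continuousOn
    ((hk.deriv hU).continuousOn.mono hRU)
  have hB₁0 : 0 ≤ B₁ := (norm_nonneg _).trans (hB₁ w₀ (Or.inl (Metric.mem_closedBall_self hR.le)))
  refine ⟨R / 2, by positivity, max B₂ (2 * B₁ / (R / 2)), fun w hw z hz => ?_⟩
  have hwR : w ∈ Metric.closedBall w₀ R := by
    rw [Metric.mem_ball] at hw; rw [Metric.mem_closedBall]; linarith
  by_cases hzw : z = w
  · rw [hzw, dslope_same]
    exact (hB₂ w hwR).trans (le_max_left _ _)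
  have hpos : 0 < ‖z - w‖ := norm_pos_iff.2 (sub_ne_zero.2 hzw)
  rw [dslope_of_ne _ hzw, slope_def_field, norm_div, div_le_iff₀ hpos]
  by_cases hzR : z ∈ Metric.closedBall w₀ R
  · refine (Convex.norm_image_sub_le_of_norm_deriv_le (C := B₂)
      (fun x hx => hk.differentiableAt (hU.mem_nhds (hRU hx))) hB₂
      (convex_closedBall w₀ R) hwR hzR).trans ?_
    exact mul_le_mul_of_nonneg_right (le_max_left _ _) hpos.le
  · have hd : R / 2 ≤ ‖z - w‖ := by
      rw [Metric.mem_closedBall, not_le] at hzR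
      rw [Metric.mem_ball] at hw
      rw [← dist_eq_norm]
      linarith [dist_triangle z w w₀]
    calc ‖k z - k w‖ ≤ B₁ + B₁ :=
          (norm_sub_le _ _).trans (add_le_add (hB₁ z (Or.inr hz)) (hB₁ w (Or.inl hwR)))
      _ = 2 * B₁ / (R / 2) * (R / 2) := by field_simp; ring
      _ ≤ max B₂ (2 * B₁ / (R / 2)) * ‖z - w‖ := by
          have : 0 ≤ 2 * B₁ / (R / 2) := by positivity
          gcongr
          exact le_max_right _ _

/-! ### Cauchy's theorem in homological form -/

/-- The kernel `ψ(u) / (z - w)`: if neither of two loops winds around `w`, its integrals along them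
agree, although `ψ(log z)` has a cut. For `w = exp v` off the cut, the integrand is a multiple of
`(z - w)⁻¹` up to the derivative of a function holomorphic in `log z` on a strip containing the
logarithms of both loops. -/
theorem exists_integral_kernel_eq (a : ℝ) {ψ : ℂ → ℂ} (hψ : Differentiable ℂ ψ) {w : ℂ}
    (hw : -w ∈ Complex.slitPlane) :
    ∃ K : ℂ, ∀ c D : ℝ → ℂ, CutLoop a c D → (∀ t ∈ Icc (0 : ℝ) 1, c t ≠ w) →
      (∫ t in (0 : ℝ)..1, (c t - w)⁻¹ * D t) = 0 →
      (∫ t in (0 : ℝ)..1, (c t - w)⁻¹ * (ψ (logLift a c t) * D t)) = K := by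
  set v := Complex.log (-w) + Real.pi * Complex.I with hv
  have hexp : Complex.exp v = w := by
    rw [hv, Complex.exp_add, Complex.exp_log (Complex.slitPlane_ne_zero hw), Complex.exp_pi_mul_I]
    ring
  have hvim : v.im = Complex.arg (-w) + Real.pi := by
    simp [hv, Complex.log_im]
  have hv0 : 0 < v.im := by rw [hvim]; linarith [Complex.neg_pi_lt_arg (-w)]
  have hv1 : v.im < 2 * Real.pi := by
    have := (Complex.arg_le_pi (-w)).lt_of_ne (Complex.mem_slitPlane_iff_arg.1 hw).1
    rw [hvim]; linarith
  set S : Set ℂ := {z | v.im - 2 * Real.pi < z.im ∧ z.im < v.im + 2 * Real.pi} with hS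
  have hSo : IsOpen S := (isOpen_lt continuous_const Complex.continuous_im).inter
    (isOpen_lt Complex.continuous_im continuous_const)
  have hSc : Convex ℝ S :=
    (convex_halfSpace_im_gt _).inter (convex_halfSpace_im_lt _)
  set N : ℂ → ℂ := fun u => Complex.exp u * (ψ u - ψ v) with hN
  have hNd : Differentiable ℂ N := Complex.differentiable_exp.mul (hψ.sub_const _)
  have hdN : Differentiable ℂ (dslope N v) := by
    rw [← differentiableOn_univ]
    exact (Complex.differentiableOn_dslope univ_mem).2 hNd.differentiableOn
  have hdE : Differentiable ℂ (dslope Complex.exp v) := by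
    rw [← differentiableOn_univ]
    exact (Complex.differentiableOn_dslope univ_mem).2 Complex.differentiable_exp.differentiableOn
  have hexpne : ∀ u ∈ S, u ≠ v → Complex.exp u ≠ Complex.exp v := by
    intro u hu huv he
    obtain ⟨n, hn⟩ := Complex.exp_eq_exp_iff_exists_int.1 he
    have him : u.im = v.im + n * (2 * Real.pi) := by
      rw [hn]; simp
    rcases lt_trichotomy n 0 with h | h | h
    · have : (n : ℝ) ≤ -1 := by exact_mod_cast Int.le_sub_one_of_lt h
      nlinarith [hu.1, Real.pi_pos]
    · exact huv (by rw [hn, h]; simp)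
    · have : (1 : ℝ) ≤ n := by exact_mod_cast h
      nlinarith [hu.2, Real.pi_pos]
  have hEne : ∀ u ∈ S, dslope Complex.exp v u ≠ 0 := by
    intro u hu
    by_cases huv : u = v
    · rw [huv, dslope_same, Complex.deriv_exp]; exact Complex.exp_ne_zero _
    · rw [dslope_of_ne _ huv, slope_def_field]
      exact div_ne_zero (sub_ne_zero.2 (hexpne u hu huv)) (sub_ne_zero.2 huv)
  set p : ℂ → ℂ := fun u => dslope N v u / dslope Complex.exp v u with hp
  have hpd : DifferentiableOn ℂ p S := hdN.differentiableOn.div hdE.differentiableOn hEne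
  obtain ⟨P, hP⟩ := hSc.exists_forall_hasDerivWithinAt hpd
  refine ⟨P (Real.log a + 2 * Real.pi * Complex.I) - P (Real.log a), fun c D h hcw hwind => ?_⟩
  have hmem : ∀ t, logLift a c t ∈ S := fun t => by
    have := im_logLift_mem (a := a) (c := c) t
    exact ⟨by linarith [this.1], by linarith [this.2]⟩
  rw [← h.integral_logLift (g := p) (fun t _ => (hP _ (hmem t)).hasDerivAt (hSo.mem_nhds (hmem t)))
    (fun t _ => (hpd.differentiableAt (hSo.mem_nhds (hmem t))).continuousAt)]
  have key : ∀ t ∈ Icc (0 : ℝ) 1, (c t - w)⁻¹ * (ψ (logLift a c t) * D t) =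
      p (logLift a c t) / c t * D t + ψ v * ((c t - w)⁻¹ * D t) := by
    intro t ht
    have hct := h.exp_logLift ht
    have h0 := h.ne_zero ht
    have h1 : c t - w ≠ 0 := sub_ne_zero.2 (hcw t ht)
    have huv : logLift a c t ≠ v := fun e => hcw t ht (by rw [← hct, e, hexp])
    have huv' : logLift a c t - v ≠ 0 := sub_ne_zero.2 huv
    have : p (logLift a c t) = c t * (ψ (logLift a c t) - ψ v) / (c t - w) := by
      simp only [hp, dslope_of_ne _ huv, slope_def_field, hN, hct, hexp, sub_self, mul_zero,
        sub_zero]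
      field_simp
    rw [this]
    field_simp
    ring
  have hi : ContinuousOn (fun t => (c t - w)⁻¹) (Icc 0 1) :=
    (h.continuousOn.sub continuousOn_const).inv₀ fun t ht => sub_ne_zero.2 (hcw t ht)
  rw [intervalIntegral.integral_congr (g := fun t =>
      p (logLift a c t) / c t * D t + ψ v * ((c t - w)⁻¹ * D t))
      (fun t ht => key t (by rwa [uIcc_of_le zero_le_one] at ht)),
    intervalIntegral.integral_add, intervalIntegral.integral_const_mul, hwind, mul_zero, add_zero]
  · refine h.intervalIntegrable_mul ?_
    refine ContinuousOn.div ?_ h.continuousOn fun t ht => h.ne_zero ht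
    exact hpd.continuousOn.comp h.continuousOn_logLift fun t _ => hmem t
  · exact (h.intervalIntegrable_mul hi).const_mul _

namespace CutLoop

variable {a : ℝ} {c D : ℝ → ℂ}

theorem isCompact_image (h : CutLoop a c D) : IsCompact (c '' Icc 0 1) :=
  isCompact_Icc.image_of_continuousOn h.continuousOn

theorem intervalIntegrable_weight (h : CutLoop a c D) {ψ : ℂ → ℂ} (hψ : Continuous ψ) :
    IntervalIntegrable (fun t => ψ (logLift a c t) * D t) MeasureTheory.volume 0 1 :=
  h.intervalIntegrable_mul (hψ.comp_continuousOn h.continuousOn_logLift)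

theorem differentiableOn_cauchy (h : CutLoop a c D) {f : ℝ → ℂ} (hf : ContinuousOn f (Icc 0 1))
    {m : ℝ → ℂ} (hm : IntervalIntegrable m MeasureTheory.volume 0 1) :
    DifferentiableOn ℂ (fun w => ∫ t in (0 : ℝ)..1, (f t * (c t - w)⁻¹) * m t)
      (c '' Icc 0 1)ᶜ := by
  have hU : IsOpen (c '' Icc 0 1)ᶜ := h.isCompact_image.isClosed.isOpen_compl
  have hne : ∀ w ∈ (c '' Icc 0 1)ᶜ, ∀ t ∈ Icc (0 : ℝ) 1, c t - w ≠ 0 := fun w hw t ht e =>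
    hw ⟨t, ht, sub_eq_zero.1 e⟩
  have hj : ContinuousOn (fun p : ℂ × ℝ => f p.2 * (c p.2 - p.1)⁻¹)
      ((c '' Icc 0 1)ᶜ ×ˢ Icc 0 1) := by
    refine (hf.comp continuousOn_snd fun p hp => hp.2).mul ?_
    exact ((h.continuousOn.comp continuousOn_snd fun p hp => hp.2).sub continuousOn_fst).inv₀
      fun p hp => hne p.1 hp.1 p.2 hp.2
  intro w hw
  refine (hasDerivAt_integral_mul hU (F := fun w t => f t * (c t - w)⁻¹) hm ?_ ?_
    (fun w hw => exists_ball_bound hU hj hw) hw).differentiableAt.differentiableWithinAt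
  · intro w hw
    exact hf.mul ((h.continuousOn.sub continuousOn_const).inv₀ (hne w hw))
  · intro t ht w hw
    exact (((differentiableAt_const _).sub differentiableAt_id).inv
      (hne w hw t ht)).const_mul _ |>.differentiableWithinAt

/-- The winding number is locally constant: `log ((z - w) / (z - w₀))` is a branch on the loop. -/
theorem eventually_winding_eq (h : CutLoop a c D) {w₀ : ℂ} (hw₀ : w₀ ∉ c '' Icc 0 1) :
    ∀ᶠ w in 𝓝 w₀, ∫ t in (0 : ℝ)..1, (c t - w)⁻¹ * D t =
      ∫ t in (0 : ℝ)..1, (c t - w₀)⁻¹ * D t := by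
  obtain ⟨r, hr, hrU⟩ := Metric.isOpen_iff.1 h.isCompact_image.isClosed.isOpen_compl w₀ hw₀
  filter_upwards [Metric.ball_mem_nhds w₀ hr] with w hw
  have hd : ∀ t ∈ Icc (0 : ℝ) 1, r ≤ ‖c t - w₀‖ := by
    intro t ht
    by_contra! hlt
    exact hrU (Metric.mem_ball.2 (by rwa [dist_eq_norm])) ⟨t, ht, rfl⟩
  have h0 : ∀ t ∈ Icc (0 : ℝ) 1, c t - w₀ ≠ 0 := fun t ht =>
    norm_pos_iff.1 (hr.trans_le (hd t ht))
  have h1 : ∀ t ∈ Icc (0 : ℝ) 1, c t - w ≠ 0 := fun t ht e =>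
    hrU hw ⟨t, ht, sub_eq_zero.1 e⟩
  rw [← sub_eq_zero, ← intervalIntegral.integral_sub]
  · have hz := h.integral_eq_zero (G := fun z => Complex.log ((z - w) / (z - w₀)))
      (g := fun z => (z - w)⁻¹ - (z - w₀)⁻¹) ?_ ?_
    · rw [← hz]
      exact intervalIntegral.integral_congr fun t _ => by ring
    · intro t ht
      have hs : (c t - w) / (c t - w₀) ∈ Complex.slitPlane := by
        have e : (c t - w) / (c t - w₀) = 1 + (w₀ - w) / (c t - w₀) := by
          have := h0 t ht
          field_simp
          ring
        rw [e]
        refine Complex.mem_slitPlane_of_norm_lt_one ?_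
        rw [norm_div, div_lt_one (norm_pos_iff.2 (h0 t ht)), ← dist_eq_norm, dist_comm]
        exact (Metric.mem_ball.1 hw).trans_le (hd t ht)
      have := (((hasDerivAt_id (c t)).sub_const w).div ((hasDerivAt_id (c t)).sub_const w₀)
        (h0 t ht)).clog hs
      refine this.congr_deriv ?_
      have := h0 t ht
      have := h1 t ht
      simp only [id, Pi.div_apply]
      field_simp
    · intro t ht
      exact ((continuousAt_id.sub continuousAt_const).inv₀ (h1 t ht)).sub
        ((continuousAt_id.sub continuousAt_const).inv₀ (h0 t ht))
  · exact h.intervalIntegrable_mul ((h.continuousOn.sub continuousOn_const).inv₀ h1)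
  · exact h.intervalIntegrable_mul ((h.continuousOn.sub continuousOn_const).inv₀ h0)

theorem eventually_norm_lt (h : CutLoop a c D) :
    ∀ᶠ w in cocompact ℂ, ∀ t ∈ Icc (0 : ℝ) 1, ‖c t‖ + 1 < ‖w‖ := by
  obtain ⟨R, hR⟩ := isCompact_Icc.exists_bound_of_continuousOn h.continuousOn
  filter_upwards [(tendsto_norm_cocompact_atTop (E := ℂ)).eventually_gt_atTop (R + 1)] with w hw t ht
  linarith [hR t ht]

/-- A loop does not wind around points far away. -/
theorem eventually_winding_eq_zero (h : CutLoop a c D) :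
    ∀ᶠ w in cocompact ℂ, ∫ t in (0 : ℝ)..1, (c t - w)⁻¹ * D t = 0 := by
  filter_upwards [h.eventually_norm_lt] with w hw
  have hw' : ∀ t ∈ Icc (0 : ℝ) 1, ‖c t‖ < ‖w‖ := fun t ht => by linarith [hw t ht]
  have hw0 : w ≠ 0 := norm_pos_iff.1 ((norm_nonneg _).trans_lt (hw' 0 (by simp)))
  have h1 : ∀ t ∈ Icc (0 : ℝ) 1, c t - w ≠ 0 := fun t ht e =>
    (hw' t ht).ne (by rw [sub_eq_zero.1 e])
  refine h.integral_eq_zero (G := fun z => Complex.log (1 + -z / w))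
    (g := fun z => (z - w)⁻¹) ?_ ?_
  · intro t ht
    have hs : 1 + -c t / w ∈ Complex.slitPlane := by
      refine Complex.mem_slitPlane_of_norm_lt_one ?_
      rw [norm_div, norm_neg, div_lt_one (norm_pos_iff.2 hw0)]
      exact hw' t ht
    have := ((((hasDerivAt_id (c t)).neg.div_const w)).const_add 1).clog hs
    refine this.congr_deriv ?_
    have h2 := h1 t ht
    have h3 : w - c t ≠ 0 := fun e => h2 (by linear_combination -e)
    have e : 1 + (-id) (c t) / w = (w - c t) / w := by
      simp only [Pi.neg_apply, id]
      field_simp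
      ring
    rw [e]
    field_simp
    ring
  · intro t ht
    exact (continuousAt_id.sub continuousAt_const).inv₀ (h1 t ht)

theorem tendsto_cauchy_cocompact (h : CutLoop a c D) {f : ℝ → ℂ} (hf : ContinuousOn f (Icc 0 1))
    {m : ℝ → ℂ} (hm : IntervalIntegrable m MeasureTheory.volume 0 1) :
    Tendsto (fun w => ∫ t in (0 : ℝ)..1, (f t * (c t - w)⁻¹) * m t) (cocompact ℂ) (𝓝 0) := by
  have hcg : (cocompact ℂ).IsCountablyGenerated := by
    rw [← Metric.cobounded_eq_cocompact, ← comap_norm_atTop]; infer_instance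
  obtain ⟨B, hB⟩ := isCompact_Icc.exists_bound_of_continuousOn hf
  have hB0 : 0 ≤ B := (norm_nonneg _).trans (hB 0 (by simp))
  have := intervalIntegral.tendsto_integral_filter_of_dominated_convergence
    (μ := MeasureTheory.volume) (a := (0 : ℝ)) (b := 1) (l := cocompact ℂ)
    (F := fun w t => (f t * (c t - w)⁻¹) * m t) (f := fun _ => 0) (fun t => B * ‖m t‖) ?_ ?_ ?_ ?_
  · simpa using this
  · filter_upwards [h.eventually_norm_lt] with w hw
    rw [uIoc_of_le zero_le_one]
    refine MeasureTheory.AEStronglyMeasurable.mul ?_ hm.1.aestronglyMeasurable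
    refine ContinuousOn.aestronglyMeasurable (ContinuousOn.mono ?_ Ioc_subset_Icc_self)
      measurableSet_Ioc
    refine hf.mul ((h.continuousOn.sub continuousOn_const).inv₀ fun t ht e => ?_)
    have := hw t ht
    rw [sub_eq_zero.1 e] at this
    linarith
  · filter_upwards [h.eventually_norm_lt] with w hw
    refine Eventually.of_forall fun t ht => ?_
    rw [uIoc_of_le zero_le_one] at ht
    have ht' := Ioc_subset_Icc_self ht
    rw [norm_mul, norm_mul, norm_inv]
    have h1 : 1 ≤ ‖c t - w‖ := by
      have := norm_sub_norm_le w (c t)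
      rw [norm_sub_rev] at this
      linarith [hw t ht']
    have h2 : ‖f t‖ * ‖c t - w‖⁻¹ ≤ B * 1 :=
      mul_le_mul (hB t ht') (inv_le_one_of_one_le₀ h1) (by positivity) hB0
    rw [mul_one] at h2
    exact mul_le_mul_of_nonneg_right h2 (norm_nonneg _)
  · exact hm.norm.const_mul B
  · refine Eventually.of_forall fun t _ => ?_
    have h1 : Tendsto (fun w : ℂ => (c t - w)⁻¹) (cocompact ℂ) (𝓝 0) := by
      rw [← Metric.cobounded_eq_cocompact]
      refine tendsto_inv₀_cobounded.comp ?_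
      simp
    simpa using (h1.const_mul (f t)).mul_const (m t)

end CutLoop

section

variable {a : ℝ} {c₁ D₁ c₂ D₂ : ℝ → ℂ}

/-- Two loops around the cut, neither of which winds around `w`, give the same integral of
`ψ(log z) / (z - w)`. For `w` on the cut this follows by continuity in `w`. -/
theorem integral_kernel_eq (h₁ : CutLoop a c₁ D₁) (h₂ : CutLoop a c₂ D₂) {ψ : ℂ → ℂ}
    (hψ : Differentiable ℂ ψ) {w : ℂ} (hw₁ : w ∉ c₁ '' Icc 0 1) (hw₂ : w ∉ c₂ '' Icc 0 1)
    (hz₁ : (∫ t in (0 : ℝ)..1, (c₁ t - w)⁻¹ * D₁ t) = 0)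
    (hz₂ : (∫ t in (0 : ℝ)..1, (c₂ t - w)⁻¹ * D₂ t) = 0) :
    (∫ t in (0 : ℝ)..1, (c₁ t - w)⁻¹ * (ψ (logLift a c₁ t) * D₁ t)) =
      ∫ t in (0 : ℝ)..1, (c₂ t - w)⁻¹ * (ψ (logLift a c₂ t) * D₂ t) := by
  have hcont : ∀ {c D : ℝ → ℂ}, CutLoop a c D → w ∉ c '' Icc 0 1 → ContinuousAt
      (fun w => ∫ t in (0 : ℝ)..1, (c t - w)⁻¹ * (ψ (logLift a c t) * D t)) w := by
    intro c D h hw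
    have := h.differentiableOn_cauchy (f := fun _ => 1) continuousOn_const
      (h.intervalIntegrable_weight hψ.continuous)
    simp only [one_mul] at this
    exact (this.differentiableAt
      (h.isCompact_image.isClosed.isOpen_compl.mem_nhds hw)).continuousAt
  have hpath : Tendsto (fun ε : ℝ => w + ε * Complex.I) (𝓝[≠] 0) (𝓝 w) := by
    have : Continuous fun ε : ℝ => w + ε * Complex.I := by fun_prop
    have h0 := (this.tendsto 0).mono_left (nhdsWithin_le_nhds (s := {0}ᶜ))
    simpa using h0
  refine tendsto_nhds_unique ((hcont h₁ hw₁).tendsto.comp hpath) ?_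
  refine ((hcont h₂ hw₂).tendsto.comp hpath).congr' ?_
  have hslit : ∀ᶠ ε : ℝ in 𝓝[≠] 0, -(w + ε * Complex.I) ∈ Complex.slitPlane := by
    by_cases him : w.im = 0
    · filter_upwards [self_mem_nhdsWithin] with ε hε
      refine Complex.mem_slitPlane_iff.2 (Or.inr ?_)
      simpa [him] using hε
    · have hs : ∀ᶠ z in 𝓝 w, -z ∈ Complex.slitPlane :=
        (continuous_neg.tendsto w).eventually (Complex.isOpen_slitPlane.mem_nhds
          (Complex.mem_slitPlane_iff.2 (Or.inr (by simpa using him))))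
      exact hpath.eventually hs
  have hav : ∀ {c D : ℝ → ℂ}, CutLoop a c D → w ∉ c '' Icc 0 1 →
      ∀ᶠ z in 𝓝 w, ∀ t ∈ Icc (0 : ℝ) 1, c t ≠ z := by
    intro c D h hw
    filter_upwards [h.isCompact_image.isClosed.isOpen_compl.mem_nhds hw] with z hz t ht e
    exact hz ⟨t, ht, e⟩
  filter_upwards [hslit, hpath.eventually (h₁.eventually_winding_eq hw₁),
    hpath.eventually (h₂.eventually_winding_eq hw₂), hpath.eventually (hav h₁ hw₁),
    hpath.eventually (hav h₂ hw₂)] with ε hs e₁ e₂ a₁ a₂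
  obtain ⟨K, hK⟩ := exists_integral_kernel_eq a hψ hs
  simp only [Function.comp]
  rw [hK c₁ D₁ h₁ a₁ (e₁.trans hz₁), hK c₂ D₂ h₂ a₂ (e₂.trans hz₂)]

namespace CutLoop

theorem differentiableAt_integral_dslope (h : CutLoop a c₁ D₁) {U : Set ℂ} (hU : IsOpen U) {k : ℂ → ℂ}
    (hk : DifferentiableOn ℂ k U) (hc : MapsTo c₁ (Icc 0 1) U)
    {m : ℝ → ℂ} (hm : IntervalIntegrable m MeasureTheory.volume 0 1) {w : ℂ} (hw : w ∈ U) :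
    DifferentiableAt ℂ (fun w => ∫ t in (0 : ℝ)..1, dslope k w (c₁ t) * m t) w := by
  have hsymm : ∀ z w, dslope k w z = dslope k z w := by
    intro z w
    rcases eq_or_ne z w with rfl | hzw
    · rfl
    · rw [dslope_of_ne _ hzw, dslope_of_ne _ hzw.symm, slope_comm]
  refine (hasDerivAt_integral_mul hU (F := fun w t => dslope k w (c₁ t)) hm ?_ ?_ ?_
    hw).differentiableAt
  · intro w hw
    have := (Complex.differentiableOn_dslope (hU.mem_nhds hw)).2 hk
    exact this.continuousOn.comp h.continuousOn hc
  · intro t ht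
    simp only [hsymm (c₁ t)]
    exact (Complex.differentiableOn_dslope (hU.mem_nhds (hc ht))).2 hk
  · intro w hw
    obtain ⟨r, hr, B, hB⟩ := exists_ball_bound_dslope hU hk h.isCompact_image hc.image_subset hw
    exact ⟨r, hr, B, fun z hz t ht => hB z hz _ (mem_image_of_mem _ ht)⟩

theorem integral_dslope_eq (h : CutLoop a c₁ D₁) {U : Set ℂ} {k : ℂ → ℂ}
    (hk : ContinuousOn k U) (hc : MapsTo c₁ (Icc 0 1) U) {w : ℂ} (hw : w ∉ c₁ '' Icc 0 1)
    {m : ℝ → ℂ} (hm : IntervalIntegrable m MeasureTheory.volume 0 1) :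
    ∫ t in (0 : ℝ)..1, dslope k w (c₁ t) * m t =
      (∫ t in (0 : ℝ)..1, (k (c₁ t) * (c₁ t - w)⁻¹) * m t) -
        k w * ∫ t in (0 : ℝ)..1, (c₁ t - w)⁻¹ * m t := by
  have hne : ∀ t ∈ Icc (0 : ℝ) 1, c₁ t - w ≠ 0 := fun t ht e => hw ⟨t, ht, sub_eq_zero.1 e⟩
  have hi : ContinuousOn (fun t => (c₁ t - w)⁻¹) (uIcc 0 1) := by
    rw [uIcc_of_le zero_le_one]
    exact (h.continuousOn.sub continuousOn_const).inv₀ hne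
  have hkc : ContinuousOn (fun t => k (c₁ t)) (uIcc 0 1) := by
    rw [uIcc_of_le zero_le_one]
    exact hk.comp h.continuousOn hc
  have hki : ContinuousOn (fun t => k (c₁ t) * (c₁ t - w)⁻¹) (uIcc 0 1) := hkc.mul hi
  rw [← intervalIntegral.integral_const_mul, ← intervalIntegral.integral_sub
    (hm.continuousOn_mul hki) ((hm.continuousOn_mul hi).const_mul _)]
  refine intervalIntegral.integral_congr fun t ht => ?_
  rw [uIcc_of_le zero_le_one] at ht
  have := hne t ht
  simp only [dslope_of_ne k (sub_ne_zero.1 this), slope_def_field]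
  field_simp

end CutLoop

/-- Dixon's argument: the difference of the two integrals of the difference quotient of `k` at `w`
against `ψ(log z) dz` extends, by Cauchy integrals where `k` is not holomorphic, to an entire
function of `w` vanishing at infinity. -/
theorem integral_dslope_eq_integral_dslope (h₁ : CutLoop a c₁ D₁) (h₂ : CutLoop a c₂ D₂)
    {U : Set ℂ} (hU : IsOpen U) {k : ℂ → ℂ} (hk : DifferentiableOn ℂ k U)
    (hc₁ : MapsTo c₁ (Icc 0 1) U) (hc₂ : MapsTo c₂ (Icc 0 1) U)
    (hw₁ : ∀ w ∉ U, ∫ t in (0 : ℝ)..1, (c₁ t - w)⁻¹ * D₁ t = 0)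
    (hw₂ : ∀ w ∉ U, ∫ t in (0 : ℝ)..1, (c₂ t - w)⁻¹ * D₂ t = 0)
    {ψ : ℂ → ℂ} (hψ : Differentiable ℂ ψ) {w : ℂ} (hw : w ∈ U) :
    ∫ t in (0 : ℝ)..1, dslope k w (c₁ t) * (ψ (logLift a c₁ t) * D₁ t) =
      ∫ t in (0 : ℝ)..1, dslope k w (c₂ t) * (ψ (logLift a c₂ t) * D₂ t) := by
  classical
  have hm₁ := h₁.intervalIntegrable_weight hψ.continuous
  have hm₂ := h₂.intervalIntegrable_weight hψ.continuous
  have hkc₁ : ContinuousOn (fun t => k (c₁ t)) (Icc 0 1) :=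
    hk.continuousOn.comp h₁.continuousOn hc₁
  have hkc₂ : ContinuousOn (fun t => k (c₂ t)) (Icc 0 1) :=
    hk.continuousOn.comp h₂.continuousOn hc₂
  set f : ℂ → ℂ := fun w =>
    (∫ t in (0 : ℝ)..1, dslope k w (c₁ t) * (ψ (logLift a c₁ t) * D₁ t)) -
      ∫ t in (0 : ℝ)..1, dslope k w (c₂ t) * (ψ (logLift a c₂ t) * D₂ t) with hf
  set g : ℂ → ℂ := fun w =>
    (∫ t in (0 : ℝ)..1, (k (c₁ t) * (c₁ t - w)⁻¹) * (ψ (logLift a c₁ t) * D₁ t)) -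
      ∫ t in (0 : ℝ)..1, (k (c₂ t) * (c₂ t - w)⁻¹) * (ψ (logLift a c₂ t) * D₂ t) with hg
  have hfg : ∀ w, w ∉ c₁ '' Icc 0 1 → w ∉ c₂ '' Icc 0 1 →
      (∫ t in (0 : ℝ)..1, (c₁ t - w)⁻¹ * D₁ t) = 0 →
      (∫ t in (0 : ℝ)..1, (c₂ t - w)⁻¹ * D₂ t) = 0 → f w = g w := by
    intro w n₁ n₂ z₁ z₂
    simp only [hf, hg]
    rw [h₁.integral_dslope_eq hk.continuousOn hc₁ n₁ hm₁,
      h₂.integral_dslope_eq hk.continuousOn hc₂ n₂ hm₂,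
      integral_kernel_eq h₁ h₂ hψ n₁ n₂ z₁ z₂]
    ring
  set H : ℂ → ℂ := fun w => if w ∈ U then f w else g w with hH
  have hHg : ∀ w, w ∉ c₁ '' Icc 0 1 → w ∉ c₂ '' Icc 0 1 →
      (∫ t in (0 : ℝ)..1, (c₁ t - w)⁻¹ * D₁ t) = 0 →
      (∫ t in (0 : ℝ)..1, (c₂ t - w)⁻¹ * D₂ t) = 0 → H w = g w := by
    intro w n₁ n₂ z₁ z₂
    simp only [hH]
    split_ifs
    · exact hfg w n₁ n₂ z₁ z₂
    · rfl
  have hdiff : Differentiable ℂ H := by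
    intro w
    by_cases hw : w ∈ U
    · have : f =ᶠ[𝓝 w] H := by
        filter_upwards [hU.mem_nhds hw] with z hz using by simp [hH, hz]
      refine DifferentiableAt.congr_of_eventuallyEq ?_ this.symm
      exact (h₁.differentiableAt_integral_dslope hU hk hc₁ hm₁ hw).sub
        (h₂.differentiableAt_integral_dslope hU hk hc₂ hm₂ hw)
    · have n₁ : w ∈ (c₁ '' Icc 0 1)ᶜ := fun h => hw (hc₁.image_subset h)
      have n₂ : w ∈ (c₂ '' Icc 0 1)ᶜ := fun h => hw (hc₂.image_subset h)
      have o₁ := h₁.isCompact_image.isClosed.isOpen_compl.mem_nhds n₁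
      have o₂ := h₂.isCompact_image.isClosed.isOpen_compl.mem_nhds n₂
      have : H =ᶠ[𝓝 w] g := by
        filter_upwards [o₁, o₂, h₁.eventually_winding_eq n₁, h₂.eventually_winding_eq n₂]
          with z a₁ a₂ b₁ b₂
        exact hHg z a₁ a₂ (b₁.trans (hw₁ w hw)) (b₂.trans (hw₂ w hw))
      refine DifferentiableAt.congr_of_eventuallyEq ?_ this
      exact ((h₁.differentiableOn_cauchy hkc₁ hm₁).differentiableAt o₁).sub
        ((h₂.differentiableOn_cauchy hkc₂ hm₂).differentiableAt o₂)
  have hlim : Tendsto H (cocompact ℂ) (𝓝 0) := by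
    have hg0 : Tendsto g (cocompact ℂ) (𝓝 0) := by
      simpa using (h₁.tendsto_cauchy_cocompact hkc₁ hm₁).sub (h₂.tendsto_cauchy_cocompact hkc₂ hm₂)
    refine hg0.congr' ?_
    filter_upwards [h₁.eventually_winding_eq_zero, h₂.eventually_winding_eq_zero,
      h₁.isCompact_image.compl_mem_cocompact, h₂.isCompact_image.compl_mem_cocompact]
      with z b₁ b₂ a₁ a₂
    exact (hHg z a₁ a₂ b₁ b₂).symm
  have := hdiff.apply_eq_of_tendsto_cocompact w hlim
  simp only [hH, hw, if_true, hf] at this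
  exact sub_eq_zero.1 this

/-- Cauchy's theorem for loops around the cut: if `k` is holomorphic on `U` and neither loop winds
around a point outside `U`, then both give the same integral of `k(z) ψ(log z) dz`. -/
theorem integral_eq_integral_of_winding_eq_zero (h₁ : CutLoop a c₁ D₁) (h₂ : CutLoop a c₂ D₂)
    {U : Set ℂ} (hU : IsOpen U) {k : ℂ → ℂ} (hk : DifferentiableOn ℂ k U)
    (hc₁ : MapsTo c₁ (Icc 0 1) U) (hc₂ : MapsTo c₂ (Icc 0 1) U)
    (hw₁ : ∀ w ∉ U, ∫ t in (0 : ℝ)..1, (c₁ t - w)⁻¹ * D₁ t = 0)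
    (hw₂ : ∀ w ∉ U, ∫ t in (0 : ℝ)..1, (c₂ t - w)⁻¹ * D₂ t = 0)
    {ψ : ℂ → ℂ} (hψ : Differentiable ℂ ψ) :
    ∫ t in (0 : ℝ)..1, k (c₁ t) * (ψ (logLift a c₁ t) * D₁ t) =
      ∫ t in (0 : ℝ)..1, k (c₂ t) * (ψ (logLift a c₂ t) * D₂ t) := by
  have haU : (a : ℂ) ∈ U := h₁.map_zero ▸ hc₁ (left_mem_Icc.2 zero_le_one)
  -- `k` is itself a difference quotient at `a`, namely that of `(z - a) k(z)`
  have hds : ∀ z, dslope (fun z => (z - a) * k z) a z = k z := by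
    intro z
    rcases eq_or_ne z a with rfl | hz
    · have hd := hk.differentiableAt (hU.mem_nhds haU)
      have := ((hasDerivAt_id (a : ℂ)).sub_const (a : ℂ)).mul hd.hasDerivAt
      rw [dslope_same]
      refine this.deriv.trans ?_
      simp
    · exact dslope_sub_smul_of_ne k hz
  have := integral_dslope_eq_integral_dslope h₁ h₂ hU (k := fun z => (z - a) * k z)
    ((differentiableOn_id.sub_const _).mul hk) hc₁ hc₂ hw₁ hw₂ hψ haU
  simpa only [hds] using this

end

/-! ### Primitives of `k(z) z ^ (-λ) ln ^ j z` near the cut -/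

theorem hasDerivAt_cpow_mul_comp {Ω : Set ℂ} (hΩ : IsOpen Ω) {k : ℂ → ℂ}
    (hk : DifferentiableOn ℂ k Ω) (ν z : ℂ) {t : ℝ} (ht : 0 < t) (htz : (t : ℂ) * z ∈ Ω) :
    HasDerivAt (fun t : ℝ => (t : ℂ) ^ ν * k (t * z))
      (ν * (t : ℂ) ^ (ν - 1) * k (t * z) + (t : ℂ) ^ ν * (z * deriv k (t * z))) t := by
  have h1 : HasDerivAt (fun x : ℂ => x ^ ν) (ν * (t : ℂ) ^ (ν - 1)) t := by
    simpa using (hasDerivAt_id (t : ℂ)).cpow_const (c := ν) (Complex.ofReal_mem_slitPlane.2 ht)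
  have h2 : HasDerivAt (fun x : ℂ => k (x * z)) (z * deriv k (t * z)) t := by
    have h := (hk.differentiableAt (hΩ.mem_nhds htz)).hasDerivAt
    have := HasDerivAt.comp (t : ℂ) h ((hasDerivAt_id (t : ℂ)).mul_const z)
    rw [one_mul, mul_comm] at this
    exact this
  exact (h1.mul h2).comp_ofReal

/-- For `Re ν > 0` the equation `ν B + z B' = k` is solved by `B(z) = ∫₀¹ k(tz) t ^ (ν - 1) dt`. -/
theorem exists_euler_solution_of_re_pos {Ω : Set ℂ} (hΩ : IsOpen Ω) (hconv : Convex ℝ Ω)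
    (h0 : (0 : ℂ) ∈ Ω) {ν : ℂ} (hν : 0 < ν.re) {k : ℂ → ℂ} (hk : DifferentiableOn ℂ k Ω) :
    ∃ B, DifferentiableOn ℂ B Ω ∧ ∀ z ∈ Ω, ν * B z + z * deriv B z = k z := by
  have hmem : ∀ z ∈ Ω, ∀ t ∈ Icc (0 : ℝ) 1, (t : ℂ) * z ∈ Ω := by
    intro z hz t ht
    have := hconv.smul_mem_of_zero_mem h0 hz ht
    rwa [Complex.real_smul] at this
  have hm : IntervalIntegrable (fun t : ℝ => (t : ℂ) ^ (ν - 1)) MeasureTheory.volume 0 1 :=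
    intervalIntegral.intervalIntegrable_cpow' (by simpa using hν)
  have hkc : ∀ z ∈ Ω, ContinuousOn (fun t : ℝ => k (t * z)) (Icc 0 1) := fun z hz =>
    hk.continuousOn.comp (by fun_prop) (hmem z hz)
  have hdk : ∀ z ∈ Ω, ContinuousOn (fun t : ℝ => deriv k (t * z)) (Icc 0 1) := fun z hz =>
    (hk.deriv hΩ).continuousOn.comp (by fun_prop) (hmem z hz)
  have hD := fun (z : ℂ) (hz : z ∈ Ω) => hasDerivAt_integral_mul hΩ (F := fun z t => k (t * z)) hm
    hkc (fun t ht => hk.comp (by fun_prop) fun z hz => hmem z hz t ht)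
    (fun z hz => exists_ball_bound hΩ (hk.continuousOn.comp (by fun_prop)
      fun p hp => hmem p.1 hp.1 p.2 hp.2) hz) hz
  refine ⟨_, fun z hz => (hD z hz).differentiableAt.differentiableWithinAt, fun z hz => ?_⟩
  rw [(hD z hz).deriv, ← intervalIntegral.integral_const_mul, ← intervalIntegral.integral_const_mul,
    ← intervalIntegral.integral_add]
  · have hν0 : ν ≠ 0 := fun h => by simp [h] at hν
    have hint := MeasureTheory.integral_eq_of_hasDerivAt_off_countable_of_le
      (fun t : ℝ => (t : ℂ) ^ ν * k (t * z))
      (fun t : ℝ => ν * (t : ℂ) ^ (ν - 1) * k (t * z) + (t : ℂ) ^ ν * (z * deriv k (t * z)))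
      zero_le_one countable_empty ?_ ?_ ?_
    · simp only [Complex.ofReal_one, Complex.one_cpow, one_mul, Complex.ofReal_zero,
        Complex.zero_cpow hν0, zero_mul, sub_zero] at hint
      rw [← hint]
      refine intervalIntegral.integral_congr_ae (Eventually.of_forall fun t ht => ?_)
      rw [uIoc_of_le zero_le_one] at ht
      have ht0 : (t : ℂ) ≠ 0 := by exact_mod_cast ht.1.ne'
      have hd : deriv (fun w => k (t * w)) z = t * deriv k (t * z) := by
        have h := (hk.differentiableAt (hΩ.mem_nhds (hmem z hz t
          (Ioc_subset_Icc_self ht)))).hasDerivAt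
        have := HasDerivAt.comp z h ((hasDerivAt_id z).const_mul (t : ℂ))
        rw [mul_one, mul_comm] at this
        exact this.deriv
      have hp : (t : ℂ) ^ ν = (t : ℂ) ^ (ν - 1) * t := by
        rw [Complex.cpow_sub _ _ ht0, Complex.cpow_one]
        field_simp
      rw [hd, hp]
      ring
    · exact ((Complex.continuous_ofReal_cpow_const hν).continuousOn).mul (hkc z hz)
    · intro t ht
      exact hasDerivAt_cpow_mul_comp hΩ hk ν z ht.1.1 (hmem z hz t (Ioo_subset_Icc_self ht.1))
    · have e1 : IntervalIntegrable (fun t : ℝ => (ν * k (t * z)) * (t : ℂ) ^ (ν - 1))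
          MeasureTheory.volume 0 1 := by
        refine hm.continuousOn_mul ?_
        rw [uIcc_of_le zero_le_one]
        exact continuousOn_const.mul (hkc z hz)
      have e2 : IntervalIntegrable (fun t : ℝ => (t : ℂ) ^ ν * (z * deriv k (t * z)))
          MeasureTheory.volume 0 1 := by
        refine ContinuousOn.intervalIntegrable ?_
        rw [uIcc_of_le zero_le_one]
        exact ((Complex.continuous_ofReal_cpow_const hν).continuousOn).mul
          (continuousOn_const.mul (hdk z hz))
      refine (e1.add e2).congr fun t _ => ?_
      ring
  · refine (hm.continuousOn_mul ?_).const_mul _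
    rw [uIcc_of_le zero_le_one]
    exact hkc z hz
  · refine IntervalIntegrable.const_mul ?_ _
    refine (hm.continuousOn_mul (g := fun t : ℝ => t * deriv k (t * z)) ?_).congr fun t ht => ?_
    · rw [uIcc_of_le zero_le_one]
      exact (Complex.continuous_ofReal.continuousOn).mul (hdk z hz)
    · rw [uIoc_of_le zero_le_one] at ht
      have h := (hk.differentiableAt (hΩ.mem_nhds (hmem z hz t
          (Ioc_subset_Icc_self ht)))).hasDerivAt
      have := HasDerivAt.comp z h ((hasDerivAt_id z).const_mul (t : ℂ))
      rw [mul_one, mul_comm] at this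
      rw [← this.deriv]
      rfl

/-- For `ν` not an integer, `ν B + z B' = k` has a holomorphic solution: splitting off the constant
term of `k` raises `ν` by `1`, until `Re ν > 0`. -/
theorem exists_euler_solution {Ω : Set ℂ} (hΩ : IsOpen Ω) (hconv : Convex ℝ Ω)
    (h0 : (0 : ℂ) ∈ Ω) {ν : ℂ} (hν : ∀ m : ℤ, ν ≠ m) {k : ℂ → ℂ} (hk : DifferentiableOn ℂ k Ω) :
    ∃ B, DifferentiableOn ℂ B Ω ∧ ∀ z ∈ Ω, ν * B z + z * deriv B z = k z := by
  obtain ⟨N, hN⟩ := exists_nat_gt (-ν.re)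
  replace hN : 0 < ν.re + N := by linarith
  induction N generalizing ν k with
  | zero => exact exists_euler_solution_of_re_pos hΩ hconv h0 (by simpa using hN) hk
  | succ N ih =>
    obtain ⟨B, hB, hBe⟩ := ih (ν := ν + 1) (fun m e => hν (m - 1) (by push_cast; rw [← e]; ring))
      ((Complex.differentiableOn_dslope (hΩ.mem_nhds h0)).2 hk)
      (by push_cast at hN; simp only [Complex.add_re, Complex.one_re]; linarith)
    have hν0 : ν ≠ 0 := by simpa using hν 0
    refine ⟨fun z => k 0 / ν + z * B z, (differentiableOn_id.mul hB).const_add _, fun z hz => ?_⟩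
    have hd := (((hasDerivAt_id z).mul
      (hB.differentiableAt (hΩ.mem_nhds hz)).hasDerivAt).const_add (k 0 / ν)).deriv
    have hk0 : z * dslope k 0 z = k z - k 0 := by
      have := sub_smul_dslope k 0 z
      simpa using this
    have e := hBe z hz
    have : deriv (fun z => k 0 / ν + z * B z) z = 1 * B z + z * deriv B z := hd
    rw [this]
    have h1 : ν * (k 0 / ν) = k 0 := by field_simp
    linear_combination h1 + z * e + hk0

/-- Iterating `exists_euler_solution` gives the coefficients of powers of the logarithm in the
primitives of `k(z) z ^ (ν - 1) ln ^ j z`. -/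
theorem exists_euler_seq {Ω : Set ℂ} (hΩ : IsOpen Ω) (hconv : Convex ℝ Ω)
    (h0 : (0 : ℂ) ∈ Ω) {ν : ℂ} (hν : ∀ m : ℤ, ν ≠ m) {k : ℂ → ℂ} (hk : DifferentiableOn ℂ k Ω) :
    ∃ A : ℕ → ℂ → ℂ, (∀ m, DifferentiableOn ℂ (A m) Ω) ∧
      (∀ z ∈ Ω, ν * A 0 z + z * deriv (A 0) z = k z) ∧
      ∀ m, ∀ z ∈ Ω, ν * A (m + 1) z + z * deriv (A (m + 1)) z = -(m + 1) * A m z := by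
  choose! S hS hSe using fun (k : ℂ → ℂ) (hk : DifferentiableOn ℂ k Ω) =>
    exists_euler_solution hΩ hconv h0 hν hk
  let A : ℕ → ℂ → ℂ := fun m =>
    Nat.rec (S k) (fun (m : ℕ) f => S (fun z => -((m : ℂ) + 1) * f z)) m
  have hA : ∀ m, DifferentiableOn ℂ (A m) Ω := by
    intro m
    induction m with
    | zero => exact hS k hk
    | succ m ih => exact hS _ (ih.const_mul _)
  exact ⟨A, hA, hSe k hk, fun m => hSe (fun z => -((m : ℂ) + 1) * A m z) ((hA m).const_mul _)⟩

/-- In the variable `u = ln z`, the primitive of `k(z) z ^ (ν - 1) ln ^ j z dz` built from the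
sequence `A` of `exists_euler_seq`. -/
noncomputable def logPrimitive (ν : ℂ) (A : ℕ → ℂ → ℂ) (j : ℕ) (u : ℂ) : ℂ :=
  Complex.exp (ν * u) *
    ∑ i ∈ Finset.range (j + 1), (j.choose i : ℂ) * A (j - i) (Complex.exp u) * u ^ i

theorem hasDerivAt_logPrimitive {Ω : Set ℂ} (hΩ : IsOpen Ω) {ν : ℂ} {k : ℂ → ℂ}
    {A : ℕ → ℂ → ℂ} (hA : ∀ m, DifferentiableOn ℂ (A m) Ω)
    (hA0 : ∀ z ∈ Ω, ν * A 0 z + z * deriv (A 0) z = k z)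
    (hAs : ∀ m, ∀ z ∈ Ω, ν * A (m + 1) z + z * deriv (A (m + 1)) z = -(m + 1) * A m z)
    (j : ℕ) {u : ℂ} (hu : Complex.exp u ∈ Ω) :
    HasDerivAt (logPrimitive ν A j)
      (k (Complex.exp u) * Complex.exp (ν * u) * u ^ j) u := by
  set z := Complex.exp u with hz
  have hE : HasDerivAt (fun u => Complex.exp (ν * u)) (Complex.exp (ν * u) * ν) u := by
    simpa using ((hasDerivAt_id u).const_mul ν).cexp
  have hAc : ∀ m, HasDerivAt (fun u => A m (Complex.exp u)) (deriv (A m) z * z) u := fun m =>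
    ((hA m).differentiableAt (hΩ.mem_nhds hu)).hasDerivAt.comp u (Complex.hasDerivAt_exp u)
  have hsum : HasDerivAt
      (fun u => ∑ i ∈ Finset.range (j + 1), (j.choose i : ℂ) * A (j - i) (Complex.exp u) * u ^ i)
      (∑ i ∈ Finset.range (j + 1), ((j.choose i : ℂ) * (deriv (A (j - i)) z * z) * u ^ i +
        (j.choose i : ℂ) * A (j - i) z * (i * u ^ (i - 1)))) u := by
    refine HasDerivAt.fun_sum fun i _ => ?_
    exact ((hAc (j - i)).const_mul (j.choose i : ℂ)).mul (hasDerivAt_pow i u)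
  refine (hE.mul hsum).congr_deriv ?_
  -- the terms coming from differentiating powers of `u` cancel by telescoping
  set T : ℕ → ℂ := fun i => (j.choose i : ℂ) * i * A (j - i) z * u ^ (i - 1) with hT
  have hterm : ∀ i ∈ Finset.range j,
      (j.choose i : ℂ) * (ν * A (j - i) z + z * deriv (A (j - i)) z) * u ^ i = -T (i + 1) := by
    intro i hi
    have hij : i < j := Finset.mem_range.1 hi
    obtain ⟨p, rfl⟩ : ∃ p, j = i + (p + 1) := ⟨j - i - 1, by omega⟩
    have e1 : i + (p + 1) - i = p + 1 := by omega
    have e2 : i + (p + 1) - (i + 1) = p := by omega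
    have hch : (((i + (p + 1)).choose (i + 1) : ℕ) : ℂ) * ((i : ℂ) + 1) =
        ((i + (p + 1)).choose i : ℕ) * ((p : ℂ) + 1) := by
      have := Nat.choose_succ_right_eq (i + (p + 1)) i
      rw [e1] at this
      exact_mod_cast this
    simp only [hT, e1, e2, hAs p z hu, Nat.add_sub_cancel]
    push_cast
    linear_combination (A p z * u ^ i) * hch
  have htot : ν * (∑ i ∈ Finset.range (j + 1), (j.choose i : ℂ) * A (j - i) z * u ^ i) +
      ∑ i ∈ Finset.range (j + 1), ((j.choose i : ℂ) * (deriv (A (j - i)) z * z) * u ^ i +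
        (j.choose i : ℂ) * A (j - i) z * (i * u ^ (i - 1))) = k z * u ^ j := by
    rw [Finset.mul_sum, ← Finset.sum_add_distrib]
    have : ∀ i ∈ Finset.range (j + 1), ν * ((j.choose i : ℂ) * A (j - i) z * u ^ i) +
        ((j.choose i : ℂ) * (deriv (A (j - i)) z * z) * u ^ i +
          (j.choose i : ℂ) * A (j - i) z * (i * u ^ (i - 1))) =
        (j.choose i : ℂ) * (ν * A (j - i) z + z * deriv (A (j - i)) z) * u ^ i + T i := by
      intro i _
      simp only [hT]
      ring
    rw [Finset.sum_congr rfl this, Finset.sum_add_distrib, Finset.sum_range_succ,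
      Finset.sum_range_succ (f := T), Finset.sum_congr rfl hterm, Finset.sum_neg_distrib]
    have htel := Finset.sum_range_sub T j
    rw [Finset.sum_sub_distrib] at htel
    have hT0 : T 0 = 0 := by simp [hT]
    have hlast : (j.choose j : ℂ) * (ν * A (j - j) z + z * deriv (A (j - j)) z) * u ^ j =
        k z * u ^ j := by
      rw [Nat.choose_self, Nat.sub_self, hA0 z hu]
      simp
    rw [hT0] at htel
    linear_combination hlast - htel
  linear_combination Complex.exp (ν * u) * htot

/-! ### The divergent part -/

theorem tendsto_cpow_mul_log_pow {ν : ℂ} (hν : 0 < ν.re) (i : ℕ) :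
    Tendsto (fun ε : ℝ => (ε : ℂ) ^ ν * (Real.log ε : ℂ) ^ i) (𝓝[>] 0) (𝓝 0) := by
  rw [tendsto_zero_iff_norm_tendsto_zero]
  have h := (isLittleO_abs_log_rpow_rpow_nhdsGT_zero (i : ℝ) (neg_lt_zero.2 hν)
    ).tendsto_div_nhds_zero
  refine h.congr' ?_
  filter_upwards [self_mem_nhdsWithin] with ε hε
  rw [norm_mul, norm_pow, Complex.norm_cpow_eq_rpow_re_of_pos hε, Complex.norm_real,
    Real.norm_eq_abs, Real.rpow_natCast, Real.rpow_neg (le_of_lt hε), div_inv_eq_mul, mul_comm]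

/-- If `B` is holomorphic at `0` and `ν` is not an integer, then `ε ^ ν B(ε) ln ^ i ε` is the sum of
a divergent part and a function tending to `0`; each Taylor coefficient of `B` that is split off
contributes one divergent term. -/
theorem exists_divergent_part {Ω : Set ℂ} (hΩ : IsOpen Ω) (h0 : (0 : ℂ) ∈ Ω) {ν : ℂ}
    (hν : ∀ m : ℤ, ν ≠ m) {B : ℂ → ℂ} (hB : DifferentiableOn ℂ B Ω) (i : ℕ) :
    ∃ D ∈ divergentTerms, Tendsto
      (fun ε : ℝ => (ε : ℂ) ^ ν * B ε * (Real.log ε : ℂ) ^ i - D ε) (𝓝[>] 0) (𝓝 0) := by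
  have hBt : ∀ {B : ℂ → ℂ}, DifferentiableOn ℂ B Ω →
      Tendsto (fun ε : ℝ => B ε) (𝓝[>] 0) (𝓝 (B 0)) := by
    intro B hB
    have h1 := (hB.differentiableAt (hΩ.mem_nhds h0)).continuousAt.tendsto
    have h2 := (Complex.continuous_ofReal.tendsto 0).mono_left
      (nhdsWithin_le_nhds (s := Ioi (0 : ℝ)))
    rw [Complex.ofReal_zero] at h2
    exact h1.comp h2
  have hbase : ∀ {ν : ℂ} {B : ℂ → ℂ}, 0 < ν.re → DifferentiableOn ℂ B Ω →
      ∃ D ∈ divergentTerms, Tendsto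
        (fun ε : ℝ => (ε : ℂ) ^ ν * B ε * (Real.log ε : ℂ) ^ i - D ε) (𝓝[>] 0) (𝓝 0) := by
    intro ν B hν hB
    refine ⟨0, zero_mem _, ?_⟩
    have := (tendsto_cpow_mul_log_pow hν i).mul (hBt hB)
    rw [zero_mul] at this
    refine this.congr fun ε => ?_
    simp only [Pi.zero_apply]
    ring
  obtain ⟨N, hN⟩ := exists_nat_gt (-ν.re)
  replace hN : 0 < ν.re + N := by linarith
  induction N generalizing ν B with
  | zero => exact hbase (by simpa using hN) hB
  | succ N ih =>
    rcases lt_or_ge 0 ν.re with hpos | hneg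
    · exact hbase hpos hB
    obtain ⟨D, hD, hlim⟩ := ih (ν := ν + 1)
      (fun m e => hν (m - 1) (by push_cast; rw [← e]; ring))
      ((Complex.differentiableOn_dslope (hΩ.mem_nhds h0)).2 hB)
      (by push_cast at hN; simp only [Complex.add_re, Complex.one_re]; linarith)
    have hν0 : ν ≠ 0 := by simpa using hν 0
    refine ⟨B 0 • scale ν i + D, add_mem (Submodule.smul_mem _ _
      (Submodule.subset_span ⟨ν, i, hneg, Or.inl hν0, rfl⟩)) hD, ?_⟩
    refine hlim.congr' ?_
    filter_upwards [self_mem_nhdsWithin] with ε hε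
    have hε0 : (ε : ℂ) ≠ 0 := by exact_mod_cast (ne_of_gt hε)
    have hb : (ε : ℂ) * dslope B 0 ε = B ε - B 0 := by
      simpa using sub_smul_dslope B 0 (ε : ℂ)
    simp only [Pi.add_apply, Pi.smul_apply, smul_eq_mul, scale, Complex.cpow_add _ _ hε0,
      Complex.cpow_one]
    linear_combination ((ε : ℂ) ^ ν * (Real.log ε : ℂ) ^ i) * hb

/-- The finite part of `∫₀ᵃ k(t) t ^ (ν - 1) ln ^ n t dt` is the value at `ln a` of the primitive of
the integrand that has no constant term. -/
theorem hasFinitePartIntegral_logPrimitive {Ω : Set ℂ} (hΩ : IsOpen Ω) {a : ℝ} (ha : 0 < a)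
    (haΩ : ∀ t ∈ Icc 0 a, (t : ℂ) ∈ Ω) {ν : ℂ} (hν : ∀ m : ℤ, ν ≠ m) {k : ℂ → ℂ}
    (hk : DifferentiableOn ℂ k Ω)
    {A : ℕ → ℂ → ℂ} (hA : ∀ m, DifferentiableOn ℂ (A m) Ω)
    (hA0 : ∀ z ∈ Ω, ν * A 0 z + z * deriv (A 0) z = k z)
    (hAs : ∀ m, ∀ z ∈ Ω, ν * A (m + 1) z + z * deriv (A (m + 1)) z = -(m + 1) * A m z)
    (n : ℕ) :
    HasFinitePartIntegral
      (fun t : ℝ => k (t : ℂ) * (t : ℂ) ^ (ν - 1) * (Real.log t : ℂ) ^ n) a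
      (logPrimitive ν A n (Real.log a)) := by
  have hexp : ∀ t : ℝ, 0 < t → Complex.exp (Real.log t) = t := fun t ht => by
    rw [← Complex.ofReal_exp, Real.exp_log ht]
  have hpow : ∀ (t : ℝ) (μ : ℂ), 0 < t → Complex.exp (μ * Real.log t) = (t : ℂ) ^ μ :=
    fun t μ ht => by
      rw [Complex.cpow_def_of_ne_zero (by exact_mod_cast ht.ne'), Complex.ofReal_log ht.le,
        mul_comm]
  have hint : ∀ ε ∈ Ioo 0 a, IntervalIntegrable
      (fun t : ℝ => k (t : ℂ) * (t : ℂ) ^ (ν - 1) * (Real.log t : ℂ) ^ n)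
      MeasureTheory.volume ε a := by
    intro ε hε
    refine ContinuousOn.intervalIntegrable ?_
    rw [uIcc_of_le hε.2.le]
    have hpos : ∀ t ∈ Icc ε a, 0 < t := fun t ht => hε.1.trans_le ht.1
    refine (ContinuousOn.mul ?_ ?_).mul ?_
    · exact hk.continuousOn.comp (by fun_prop) fun t ht => haΩ t ⟨(hpos t ht).le, ht.2⟩
    · exact ContinuousOn.cpow_const (by fun_prop) fun t ht =>
        Complex.ofReal_mem_slitPlane.2 (hpos t ht)
    · refine (Complex.continuous_ofReal.comp_continuousOn ?_).pow n
      exact Real.continuousOn_log.mono fun t ht => (hpos t ht).ne'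
  refine ⟨hint, ?_⟩
  have hterm := fun i => exists_divergent_part hΩ
    (by simpa using haΩ 0 (left_mem_Icc.2 ha.le)) hν (hA (n - i)) i
  choose D hD hlim using hterm
  refine ⟨-∑ i ∈ Finset.range (n + 1), (n.choose i : ℂ) • D i, neg_mem (sum_mem fun i _ =>
    Submodule.smul_mem _ _ (hD i)), ?_⟩
  have hsum := tendsto_finsetSum (Finset.range (n + 1)) fun i _ =>
    (hlim i).const_mul (n.choose i : ℂ)
  simp only [mul_zero, Finset.sum_const_zero] at hsum
  have hsub := hsum.const_sub (logPrimitive ν A n (Real.log a))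
  rw [sub_zero] at hsub
  refine hsub.congr' ?_
  filter_upwards [Ioo_mem_nhdsGT ha] with ε hε
  have hFTC : ∫ t in ε..a, k (t : ℂ) * (t : ℂ) ^ (ν - 1) * (Real.log t : ℂ) ^ n =
      logPrimitive ν A n (Real.log a) - logPrimitive ν A n (Real.log ε) := by
    refine intervalIntegral.integral_eq_sub_of_hasDerivAt
      (f := fun t : ℝ => logPrimitive ν A n (Real.log t)) ?_ (hint ε hε)
    intro t ht
    rw [uIcc_of_le hε.2.le] at ht
    have ht0 : 0 < t := hε.1.trans_le ht.1
    have htc : (t : ℂ) ≠ 0 := by exact_mod_cast ht0.ne'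
    have hmem : Complex.exp (Real.log t) ∈ Ω := by
      rw [hexp t ht0]; exact haΩ t ⟨ht0.le, ht.2⟩
    have := (hasDerivAt_logPrimitive hΩ hA hA0 hAs n hmem).comp t
      (Real.hasDerivAt_log ht0.ne').ofReal_comp
    refine this.congr_deriv ?_
    rw [hexp t ht0, hpow t ν ht0, Complex.cpow_sub _ _ htc, Complex.cpow_one]
    push_cast
    field_simp
  rw [hFTC]
  have hL : logPrimitive ν A n (Real.log ε) = ∑ i ∈ Finset.range (n + 1), (n.choose i : ℂ) *
      ((ε : ℂ) ^ ν * A (n - i) ε * (Real.log ε : ℂ) ^ i) := by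
    rw [logPrimitive, hpow ε ν hε.1, hexp ε hε.1, Finset.mul_sum]
    exact Finset.sum_congr rfl fun i _ => by ring
  simp only [mul_sub, Finset.sum_sub_distrib, ← hL, Pi.neg_apply, Finset.sum_apply, Pi.smul_apply,
    smul_eq_mul]
  ring

/-! ### Exponential generating functions -/

/-- The exponential generating function of a sequence. -/
noncomputable def egf (f : ℕ → ℂ) : PowerSeries ℂ :=
  PowerSeries.mk fun n => f n / (n.factorial : ℂ)

theorem coeff_egf (f : ℕ → ℂ) (n : ℕ) :
    PowerSeries.coeff n (egf f) = f n / (n.factorial : ℂ) :=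
  PowerSeries.coeff_mk _ _

theorem coeff_egf_mul (f g : ℕ → ℂ) (n : ℕ) :
    PowerSeries.coeff n (egf f * egf g) =
      (∑ j ∈ Finset.range (n + 1), (n.choose j : ℂ) * f j * g (n - j)) / (n.factorial : ℂ) := by
  rw [PowerSeries.coeff_mul, Finset.Nat.sum_antidiagonal_eq_sum_range_succ_mk, Finset.sum_div]
  refine Finset.sum_congr rfl fun j hj => ?_
  have hjn : j ≤ n := Nat.lt_succ_iff.1 (Finset.mem_range.1 hj)
  have h1 : (j.factorial : ℂ) ≠ 0 := by exact_mod_cast j.factorial_ne_zero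
  have h2 : ((n - j).factorial : ℂ) ≠ 0 := by exact_mod_cast (n - j).factorial_ne_zero
  have h3 : (n.factorial : ℂ) ≠ 0 := by exact_mod_cast n.factorial_ne_zero
  simp only [coeff_egf]
  rw [Nat.cast_choose ℂ hjn]
  field_simp

theorem rescale_egf (τ : ℂ) (f : ℕ → ℂ) :
    PowerSeries.rescale τ (egf f) = egf fun n => τ ^ n * f n := by
  ext n
  rw [PowerSeries.coeff_rescale, coeff_egf, coeff_egf, mul_div_assoc]

theorem rescale_exp_eq_egf (τ : ℂ) :
    PowerSeries.rescale τ (PowerSeries.exp ℂ) = egf fun n => τ ^ n := by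
  ext n
  rw [PowerSeries.coeff_rescale, coeff_egf, PowerSeries.coeff_exp]
  simp [div_eq_mul_inv]

/-- `(exp X - 1) ^ l` is `l!` times the exponential generating function of the Stirling numbers of
the second kind; both sides satisfy `F_l' = l (F_l + F_{l-1})`. -/
theorem exp_sub_one_pow_eq_egf (l : ℕ) :
    (PowerSeries.exp ℂ - 1) ^ l =
      egf fun m => (l.factorial : ℂ) * (Nat.stirlingSecond m l : ℂ) := by
  ext m
  rw [coeff_egf]
  induction m generalizing l with
  | zero =>
    rw [PowerSeries.coeff_zero_eq_constantCoeff_apply]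
    cases l <;> simp [PowerSeries.constantCoeff_exp]
  | succ m ih =>
    cases l with
    | zero => simp [PowerSeries.coeff_one]
    | succ l =>
      have hd : PowerSeries.derivative ℂ ((PowerSeries.exp ℂ - 1) ^ (l + 1)) =
          ((l : PowerSeries ℂ) + 1) *
            ((PowerSeries.exp ℂ - 1) ^ (l + 1) + (PowerSeries.exp ℂ - 1) ^ l) := by
        rw [Derivation.leibniz_pow, map_sub, PowerSeries.derivative_exp, Derivation.map_one_eq_zero,
          sub_zero, Nat.add_sub_cancel, nsmul_eq_mul, smul_eq_mul]
        push_cast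
        ring
      have hc := congrArg (PowerSeries.coeff m) hd
      have hl : ((l : PowerSeries ℂ) + 1) = PowerSeries.C ((l : ℂ) + 1) := by simp
      rw [PowerSeries.coeff_derivative, hl, PowerSeries.coeff_C_mul, map_add, ih, ih] at hc
      have hm : ((m : ℂ) + 1) ≠ 0 := by exact_mod_cast m.succ_ne_zero
      have hf : (m.factorial : ℂ) ≠ 0 := by exact_mod_cast m.factorial_ne_zero
      rw [← mul_left_inj' hm, hc, Nat.stirlingSecond_succ_succ, Nat.factorial_succ m,
        Nat.factorial_succ l]
      push_cast
      field_simp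

/-- The Taylor coefficients of `1 / (q exp x - 1)` at `0`. -/
noncomputable def invExpCoeff (q : ℂ) (m : ℕ) : ℂ :=
  ∑ l ∈ Finset.range (m + 1), (-1) ^ l * (l.factorial : ℂ) * (Nat.stirlingSecond m l : ℂ) *
    (q ^ l / (q - 1) ^ (l + 1))

/-- Geometric series in `exp X - 1`: `q exp X - 1 = (q - 1) (1 + q / (q - 1) (exp X - 1))`. -/
theorem egf_invExpCoeff_mul {q : ℂ} (hq : q ≠ 1) :
    egf (invExpCoeff q) * (PowerSeries.C q * PowerSeries.exp ℂ - 1) = 1 := by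
  have hq' : q - 1 ≠ 0 := sub_ne_zero.2 hq
  ext m
  set Y : PowerSeries ℂ := PowerSeries.exp ℂ - 1 with hY
  set x : PowerSeries ℂ := PowerSeries.C (-(q / (q - 1))) * Y with hx
  set B : PowerSeries ℂ := PowerSeries.C ((q - 1)⁻¹) * ∑ l ∈ Finset.range (m + 1), x ^ l with hB
  have hxl : ∀ p l, PowerSeries.coeff p (x ^ l) =
      (-(q / (q - 1))) ^ l * ((l.factorial : ℂ) * (Nat.stirlingSecond p l : ℂ) / p.factorial) := by
    intro p l
    rw [hx, mul_pow, ← map_pow, PowerSeries.coeff_C_mul, hY, exp_sub_one_pow_eq_egf, coeff_egf]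
  have hcoeff : ∀ p ≤ m, PowerSeries.coeff p (egf (invExpCoeff q)) = PowerSeries.coeff p B := by
    intro p hp
    rw [hB, PowerSeries.coeff_C_mul, map_sum, coeff_egf, invExpCoeff,
      Finset.sum_subset (Finset.range_subset_range.2 (Nat.succ_le_succ hp)), Finset.sum_div,
      Finset.mul_sum]
    · refine Finset.sum_congr rfl fun l _ => ?_
      rw [hxl, neg_pow (q / (q - 1)), div_pow, pow_succ]
      field_simp
    · intro l _ hl
      rw [Finset.mem_range, not_lt] at hl
      rw [Nat.stirlingSecond_eq_zero_of_lt hl]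
      simp
  have hmul : PowerSeries.coeff m (egf (invExpCoeff q) * (PowerSeries.C q * PowerSeries.exp ℂ - 1))
      = PowerSeries.coeff m (B * (PowerSeries.C q * PowerSeries.exp ℂ - 1)) := by
    rw [PowerSeries.coeff_mul, PowerSeries.coeff_mul]
    refine Finset.sum_congr rfl fun p hp => ?_
    have hpm := Finset.HasAntidiagonal.mem_antidiagonal.1 hp
    rw [hcoeff p.1 (by omega)]
  have hfac : PowerSeries.C q * PowerSeries.exp ℂ - 1 = PowerSeries.C (q - 1) * (1 - x) := by
    have h1 : PowerSeries.C (q - 1) * PowerSeries.C (-(q / (q - 1))) = -PowerSeries.C q := by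
      rw [← map_mul, ← map_neg]
      congr 1
      field_simp
    have h2 : PowerSeries.C (q - 1) = PowerSeries.C q - 1 := by simp
    linear_combination Y * h1 - h2
  have hinv : PowerSeries.C ((q - 1)⁻¹) * PowerSeries.C (q - 1) = 1 := by
    rw [← map_mul, inv_mul_cancel₀ hq', map_one]
  have hprod : B * (PowerSeries.C q * PowerSeries.exp ℂ - 1) = 1 - x ^ (m + 1) := by
    rw [hfac, ← geom_sum_mul_neg x (m + 1), hB]
    linear_combination ((∑ l ∈ Finset.range (m + 1), x ^ l) * (1 - x)) * hinv
  rw [hmul, hprod, map_sub, hxl, Nat.stirlingSecond_eq_zero_of_lt (Nat.lt_succ_self m)]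
  simp

/-- Inversion of the relation between the sequences `T` and `J` that express integrals along the
two sides of the cut and around it. -/
theorem sum_choose_mul_invExpCoeff {q : ℂ} (hq : q ≠ 1) (τ : ℂ) {J T : ℕ → ℂ}
    (h : egf J =
      (PowerSeries.C q * PowerSeries.rescale τ (PowerSeries.exp ℂ) - 1) * egf T) (n : ℕ) :
    ∑ j ∈ Finset.range (n + 1), (n.choose j : ℂ) * τ ^ (n - j) * invExpCoeff q (n - j) * J j =
      T n := by
  have hr := congrArg (PowerSeries.rescale τ) (egf_invExpCoeff_mul hq)
  have hC : PowerSeries.rescale τ (PowerSeries.C q) = PowerSeries.C q := by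
    ext m
    rw [PowerSeries.coeff_rescale, PowerSeries.coeff_C]
    split_ifs with hm
    · simp [hm]
    · simp
  rw [map_mul, map_sub, map_mul, map_one, hC, rescale_egf] at hr
  have hJT : egf J * egf (fun m => τ ^ m * invExpCoeff q m) = egf T := by
    rw [h]
    linear_combination egf T * hr
  have hc := congrArg (PowerSeries.coeff n) hJT
  have hf : (n.factorial : ℂ) ≠ 0 := by exact_mod_cast n.factorial_ne_zero
  rw [coeff_egf_mul, coeff_egf, div_left_inj' hf] at hc
  rw [← hc]
  exact Finset.sum_congr rfl fun j _ => by ring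

theorem egf_logPrimitive (ν : ℂ) (A : ℕ → ℂ → ℂ) (u : ℂ) :
    egf (fun j => logPrimitive ν A j u) = PowerSeries.C (Complex.exp (ν * u)) *
      (PowerSeries.rescale u (PowerSeries.exp ℂ) * egf fun m => A m (Complex.exp u)) := by
  ext n
  rw [rescale_exp_eq_egf, PowerSeries.coeff_C_mul, coeff_egf_mul, coeff_egf, logPrimitive,
    mul_div_assoc]
  congr 2
  exact Finset.sum_congr rfl fun i _ => by ring

/-- The jump of the primitives across the cut. -/
theorem egf_logPrimitive_sub (ν : ℂ) (A : ℕ → ℂ → ℂ) (u : ℂ) :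
    egf (fun j => logPrimitive ν A j (u + 2 * Real.pi * Complex.I) - logPrimitive ν A j u) =
      (PowerSeries.C (Complex.exp (ν * (2 * Real.pi * Complex.I))) *
        PowerSeries.rescale (2 * Real.pi * Complex.I : ℂ) (PowerSeries.exp ℂ) - 1) *
          egf fun j => logPrimitive ν A j u := by
  have hsub : egf (fun j => logPrimitive ν A j (u + 2 * Real.pi * Complex.I) -
      logPrimitive ν A j u) = egf (fun j => logPrimitive ν A j (u + 2 * Real.pi * Complex.I)) -
        egf fun j => logPrimitive ν A j u := by
    ext n
    simp only [map_sub, coeff_egf, sub_div]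
  have hexp : Complex.exp (u + 2 * Real.pi * Complex.I) = Complex.exp u := by
    rw [Complex.exp_add, Complex.exp_two_pi_mul_I, mul_one]
  rw [hsub, egf_logPrimitive, egf_logPrimitive, hexp, ← PowerSeries.exp_mul_exp_eq_exp_add,
    mul_add, Complex.exp_add, map_mul]
  ring

/-! ### Contours as loops around the cut -/

theorem cutLog_eq_log_neg {z : ℂ} (hz : -z ∈ Complex.slitPlane) :
    cutLog z = Complex.log (-z) + Real.pi * Complex.I := by
  rcases lt_trichotomy z.im 0 with him | him | him
  · rw [log_neg_of_im_neg him, cutLog, cutArg, if_neg (not_le.2 (Complex.arg_neg_iff.2 him)),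
      Complex.log]
    push_cast
    ring
  · have hre : z.re < 0 := by
      rcases Complex.mem_slitPlane_iff.1 hz with h | h
      · simpa using h
      · simp [him] at h
    have hz' : z = (z.re : ℂ) := Complex.ext rfl (by simpa using him)
    have h1 : Complex.arg z = Real.pi := Complex.arg_eq_pi_iff.2 ⟨hre, him⟩
    have h2 : Complex.arg (-z) = 0 := by
      rw [hz', ← Complex.ofReal_neg, Complex.arg_ofReal_of_nonneg (by linarith)]
    rw [cutLog, cutArg, h1, if_pos Real.pi_pos.le, Complex.log, h2, norm_neg]
    simp
  · rw [log_neg_of_im_pos him, cutLog, cutArg, if_pos (Complex.arg_nonneg_iff.2 him.le),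
      Complex.log]

namespace IsPiecewiseC1

variable {p q : ℂ} {γ : Path p q}

theorem exists_hasDerivAt (h : IsPiecewiseC1 γ) : ∃ s : Set ℝ, s.Countable ∧
    ∀ t ∈ Ioo (0 : ℝ) 1 \ s, HasDerivAt γ.extend (derivWithin γ.extend I t) t := by
  obtain ⟨s, hs⟩ := h
  refine ⟨s, s.countable_toSet, fun t ht => ?_⟩
  have hopen : Ioo (0 : ℝ) 1 \ s ∈ 𝓝 t :=
    (isOpen_Ioo.sdiff s.finite_toSet.isClosed).mem_nhds ht
  obtain ⟨ε, hε, hsub⟩ := Metric.nhds_basis_closedBall.mem_iff.1 hopen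
  rw [Real.closedBall_eq_Icc] at hsub
  have hle : t - ε ≤ t + ε := by linarith
  have h1 := (hsub (left_mem_Icc.2 hle)).1
  have h2 := (hsub (right_mem_Icc.2 hle)).1
  have hC := hs (t - ε) (t + ε) h1.1.le (by linarith) h2.2.le
    fun b hb hb' => (hsub (Ioo_subset_Icc_self hb')).2 hb
  have hd : DifferentiableAt ℝ γ.extend t :=
    (hC.differentiableOn one_ne_zero).differentiableAt (Icc_mem_nhds (by linarith) (by linarith))
  rw [derivWithin_of_mem_nhds (Icc_mem_nhds ht.1.1 ht.1.2)]
  exact hd.hasDerivAt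

theorem intervalIntegrable_derivWithin (h : IsPiecewiseC1 γ) :
    IntervalIntegrable (derivWithin γ.extend I) MeasureTheory.volume 0 1 := by
  classical
  obtain ⟨s, hs⟩ := h
  -- bisect at break points, by induction on their number between `x` and `y`
  suffices H : ∀ N : ℕ, ∀ x y : ℝ, 0 ≤ x → x < y → y ≤ 1 →
      (s.filter (· ∈ Ioo x y)).card ≤ N →
      IntervalIntegrable (derivWithin γ.extend I) MeasureTheory.volume x y from
    H _ 0 1 le_rfl one_pos le_rfl le_rfl
  intro N
  induction N with
  | zero =>
    intro x y hx hxy hy hN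
    have hempty : ∀ b ∈ s, b ∉ Ioo x y := by
      intro b hb hb'
      have : b ∈ s.filter (· ∈ Ioo x y) := Finset.mem_filter.2 ⟨hb, hb'⟩
      rw [Finset.card_eq_zero.1 (Nat.le_zero.1 hN)] at this
      simp at this
    have hC := (hs x y hx hxy hy hempty).continuousOn_derivWithin (uniqueDiffOn_Icc hxy) le_rfl
    have hint := hC.intervalIntegrable_of_Icc (μ := MeasureTheory.volume) hxy.le
    refine hint.congr_ae ?_
    rw [uIoc_of_le hxy.le, ← MeasureTheory.Measure.restrict_congr_set
      MeasureTheory.Ioo_ae_eq_Ioc]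
    filter_upwards [MeasureTheory.ae_restrict_mem measurableSet_Ioo] with t ht
    rw [derivWithin_of_mem_nhds (Icc_mem_nhds ht.1 ht.2),
      derivWithin_of_mem_nhds (Icc_mem_nhds (hx.trans_lt ht.1) (ht.2.trans_le hy))]
  | succ N ih =>
    intro x y hx hxy hy hN
    by_cases hempty : ∃ b ∈ s, b ∈ Ioo x y
    · obtain ⟨b, hb, hb'⟩ := hempty
      have hmem : b ∈ s.filter (· ∈ Ioo x y) := Finset.mem_filter.2 ⟨hb, hb'⟩
      have hcard : ∀ x' y' : ℝ, x ≤ x' → y' ≤ y → b ∉ Ioo x' y' →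
          (s.filter (· ∈ Ioo x' y')).card ≤ N := by
        intro x' y' hx' hy' hbn
        refine Nat.le_of_lt_succ (lt_of_lt_of_le (Finset.card_lt_card ?_) hN)
        refine (Finset.ssubset_iff_of_subset fun z hz => ?_).2
          ⟨b, hmem, fun hz => hbn (Finset.mem_filter.1 hz).2⟩
        obtain ⟨h1, h2⟩ := Finset.mem_filter.1 hz
        exact Finset.mem_filter.2 ⟨h1, hx'.trans_lt h2.1, h2.2.trans_le hy'⟩
      exact (ih x b hx hb'.1 (hb'.2.le.trans hy) (hcard x b le_rfl hb'.2.le (by simp))).trans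
        (ih b y (hx.trans hb'.1.le) hb'.2 hy (hcard b y hb'.1.le le_rfl (by simp)))
    · refine ih x y hx hxy hy ?_
      rw [Finset.filter_eq_empty_iff.2 fun b hb hb' => hempty ⟨b, hb, hb'⟩]
      simp

end IsPiecewiseC1

namespace IsCutContour

variable {k : ℂ → ℂ} {a : ℝ} {C : Path (a : ℂ) (a : ℂ)}

theorem cutLoop (h : IsCutContour k a C) (ha : 0 < a) :
    CutLoop a C.extend (derivWithin C.extend I) where
  pos := ha
  continuousOn := C.continuous_extend.continuousOn
  map_zero := C.extend_zero
  map_one := C.extend_one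
  neg_mem_slitPlane t ht := by
    rw [Complex.mem_slitPlane_iff]
    by_contra! hcon
    obtain ⟨hre, him⟩ := hcon
    simp only [Complex.neg_re, Complex.neg_im, neg_eq_zero] at hre him
    exact h.avoids_cut t ht (C.extend t).re (by linarith)
      (Complex.ext rfl (by simpa using him))
  starts_above := h.starts_above
  ends_below := h.ends_below
  intervalIntegrable := h.piecewiseC1.intervalIntegrable_derivWithin
  hasDerivAt := h.piecewiseC1.exists_hasDerivAt

end IsCutContour

theorem contourIntegral_eq_integral (f : ℂ → ℂ) {p q : ℂ} (γ : Path p q) :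
    contourIntegral f γ = ∫ t in (0 : ℝ)..1, f (γ.extend t) * derivWithin γ.extend I t := by
  rw [contourIntegral, curveIntegral_def]
  refine intervalIntegral.integral_congr fun t _ => ?_
  simp [curveIntegralFun_def, formDz]

theorem contourIntegrable_iff (f : ℂ → ℂ) {p q : ℂ} (γ : Path p q) :
    ContourIntegrable f γ ↔ IntervalIntegrable
      (fun t => f (γ.extend t) * derivWithin γ.extend I t) MeasureTheory.volume 0 1 := by
  have : curveIntegralFun (formDz f) γ =
      fun t => f (γ.extend t) * derivWithin γ.extend I t := by
    ext t
    simp [curveIntegralFun_def, formDz]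
  rw [ContourIntegrable, CurveIntegrable, this]

/-- A thin ellipse around `[0, a]`, starting at `a`. -/
noncomputable def ellipse (a η : ℝ) (t : ℝ) : ℂ :=
  ((a * Real.cos (Real.pi * t) ^ 2 - η * Real.sin (Real.pi * t) ^ 2 : ℝ) : ℂ) +
    ((η * Real.sin (2 * Real.pi * t) : ℝ) : ℂ) * Complex.I

theorem ellipse_re (a η t : ℝ) : (ellipse a η t).re =
    a * Real.cos (Real.pi * t) ^ 2 - η * Real.sin (Real.pi * t) ^ 2 := by
  rw [ellipse, Complex.add_re, Complex.re_ofReal_mul, Complex.ofReal_re, Complex.I_re]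
  ring

theorem ellipse_im (a η t : ℝ) : (ellipse a η t).im = η * Real.sin (2 * Real.pi * t) := by
  rw [ellipse, Complex.add_im, Complex.im_ofReal_mul, Complex.ofReal_im, Complex.I_im]
  ring

theorem contDiff_ellipse (a η : ℝ) : ContDiff ℝ 1 (ellipse a η) := by
  unfold ellipse
  refine ContDiff.add (Complex.ofRealCLM.contDiff.comp ?_)
    ((Complex.ofRealCLM.contDiff.comp ?_).mul contDiff_const)
  · exact (contDiff_const.mul ((Real.contDiff_cos.comp (contDiff_const.mul contDiff_id)).pow 2)).sub
      (contDiff_const.mul ((Real.contDiff_sin.comp (contDiff_const.mul contDiff_id)).pow 2))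
  · exact contDiff_const.mul (Real.contDiff_sin.comp (contDiff_const.mul contDiff_id))

theorem cutLoop_ellipse {a η : ℝ} (ha : 0 < a) (hη : 0 < η) :
    CutLoop a (ellipse a η) (deriv (ellipse a η)) where
  pos := ha
  continuousOn := (contDiff_ellipse a η).continuous.continuousOn
  map_zero := by simp [ellipse]
  map_one := by simp [ellipse]
  neg_mem_slitPlane t ht := by
    have hp := Real.pi_pos
    have hsin : 0 < Real.sin (Real.pi * t) :=
      Real.sin_pos_of_pos_of_lt_pi (by nlinarith [ht.1]) (by nlinarith [ht.2])
    rw [Complex.mem_slitPlane_iff, Complex.neg_re, Complex.neg_im, ellipse_re, ellipse_im]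
    by_cases hcos : Real.cos (Real.pi * t) = 0
    · refine Or.inl ?_
      rw [hcos]
      nlinarith [mul_pos hη (pow_pos hsin 2)]
    · refine Or.inr (neg_ne_zero.2 (mul_ne_zero hη.ne' ?_))
      rw [mul_assoc, Real.sin_two_mul]
      exact mul_ne_zero (mul_ne_zero two_ne_zero hsin.ne') hcos
  starts_above := by
    filter_upwards [Ioo_mem_nhdsGT (show (0 : ℝ) < 1 / 2 by norm_num)] with t ht
    have hp := Real.pi_pos
    rw [ellipse_im]
    exact mul_pos hη (Real.sin_pos_of_pos_of_lt_pi (by nlinarith [ht.1]) (by nlinarith [ht.2]))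
  ends_below := by
    filter_upwards [Ioo_mem_nhdsLT (show (1 / 2 : ℝ) < 1 by norm_num)] with t ht
    have hp := Real.pi_pos
    rw [ellipse_im, ← Real.sin_sub_two_pi]
    exact mul_neg_of_pos_of_neg hη
      (Real.sin_neg_of_neg_of_neg_pi_lt (by nlinarith [ht.2]) (by nlinarith [ht.1]))
  intervalIntegrable :=
    ((contDiff_ellipse a η).continuous_deriv le_rfl).intervalIntegrable _ _
  hasDerivAt := ⟨∅, countable_empty, fun t _ =>
    ((contDiff_ellipse a η).differentiable one_ne_zero t).hasDerivAt⟩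

theorem ellipse_mem_thickening {a η δ : ℝ} (ha : 0 < a) (hη : 0 < η) (hδ : 2 * η < δ) (t : ℝ) :
    ellipse a η t ∈ Metric.thickening δ (Complex.ofReal '' Icc 0 a) := by
  refine Metric.mem_thickening_iff.2 ⟨((a * Real.cos (Real.pi * t) ^ 2 : ℝ) : ℂ), ⟨_, ⟨by positivity,
    mul_le_of_le_one_right ha.le (Real.cos_sq_le_one _)⟩, rfl⟩, ?_⟩
  have e : ellipse a η t - ((a * Real.cos (Real.pi * t) ^ 2 : ℝ) : ℂ) =
      ((-(η * Real.sin (Real.pi * t) ^ 2) : ℝ) : ℂ) +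
        ((η * Real.sin (2 * Real.pi * t) : ℝ) : ℂ) * Complex.I := by
    rw [ellipse]; push_cast; ring
  rw [dist_eq_norm, e]
  refine lt_of_le_of_lt (norm_add_le _ _) (lt_of_le_of_lt (add_le_add (b := η) (d := η) ?_ ?_)
    (by linarith))
  · rw [Complex.norm_real, Real.norm_eq_abs, abs_neg, abs_of_nonneg (by positivity)]
    exact mul_le_of_le_one_right hη.le (Real.sin_sq_le_one _)
  · rw [norm_mul, Complex.norm_I, mul_one, Complex.norm_real, Real.norm_eq_abs, abs_mul,
      abs_of_pos hη]
    exact mul_le_of_le_one_right hη.le (Real.abs_sin_le_one _)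

theorem beta_eq_invExpCoeff (n j : ℕ) (lam : ℂ) :
    beta n j lam = invExpCoeff (Complex.exp (-2 * Real.pi * Complex.I * lam)) (n - j) := by
  unfold beta invExpCoeff
  refine Finset.sum_congr rfl fun l _ => ?_
  rw [← Complex.exp_nat_mul, mul_comm (l : ℂ)]

theorem exp_neg_two_pi_I_mul_ne_one {lam : ℂ} (hlam : ∀ m : ℤ, lam ≠ m) :
    Complex.exp (-2 * Real.pi * Complex.I * lam) ≠ 1 := by
  intro h
  obtain ⟨m, hm⟩ := Complex.exp_eq_one_iff.1 h
  refine hlam (-m) ?_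
  have h2 := Complex.two_pi_I_ne_zero
  refine mul_right_cancel₀ h2 ?_
  push_cast
  linear_combination -hm

namespace IsCutContour

variable {k : ℂ → ℂ} {a : ℝ} {C : Path (a : ℂ) (a : ℂ)}

/-- The multivalued factor `z ^ (-λ) ln ^ j z` on the contour in terms of the continuous logarithm.
At the endpoint `t = 1`, where the two logarithms differ, nothing is claimed. -/
theorem integrand_eq (h : IsCutContour k a C) (ha : 0 < a) (lam : ℂ) (j : ℕ) {t : ℝ}
    (ht : t ∈ Ioo (0 : ℝ) 1) :
    k (C.extend t) * cutPow (C.extend t) (-lam) * cutLog (C.extend t) ^ j =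
      k (C.extend t) * (Complex.exp (-lam * logLift a C.extend t) * logLift a C.extend t ^ j) := by
  rw [cutPow, cutLog_eq_log_neg ((h.cutLoop ha).neg_mem_slitPlane t ht), logLift_of_mem ht]
  ring

theorem mapsTo_analyticAt (h : IsCutContour k a C) :
    MapsTo C.extend (Icc 0 1) {z | AnalyticAt ℂ k z} := by
  intro t ht
  have := h.analyticAt ⟨t, ht⟩
  rwa [← Path.extend_apply C ht] at this

theorem ae_integrand_eq (h : IsCutContour k a C) (ha : 0 < a) (lam : ℂ) (j : ℕ) :
    ∀ᵐ t : ℝ, t ∈ uIoc (0 : ℝ) 1 →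
      k (C.extend t) * cutPow (C.extend t) (-lam) * cutLog (C.extend t) ^ j *
          derivWithin C.extend I t =
        k (C.extend t) * ((Complex.exp (-lam * logLift a C.extend t) * logLift a C.extend t ^ j) *
          derivWithin C.extend I t) := by
  filter_upwards [MeasureTheory.Measure.ae_ne MeasureTheory.volume (1 : ℝ)] with t ht1 ht
  rw [uIoc_of_le zero_le_one] at ht
  rw [h.integrand_eq ha lam j ⟨ht.1, lt_of_le_of_ne ht.2 ht1⟩, mul_assoc]

theorem contourIntegrable (h : IsCutContour k a C) (ha : 0 < a) (lam : ℂ) (j : ℕ) :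
    ContourIntegrable (fun z => k z * cutPow z (-lam) * cutLog z ^ j) C := by
  rw [contourIntegrable_iff]
  have hk : ContinuousOn (fun t => k (C.extend t)) (uIcc 0 1) := by
    rw [uIcc_of_le zero_le_one]
    intro t ht
    exact (h.mapsTo_analyticAt ht).continuousAt.comp_continuousWithinAt
      (C.continuous_extend.continuousOn t ht)
  have hψ : Continuous fun u : ℂ => Complex.exp (-lam * u) * u ^ j := by fun_prop
  refine (((h.cutLoop ha).intervalIntegrable_weight hψ).continuousOn_mul hk).congr_ae ?_
  rw [Filter.EventuallyEq, MeasureTheory.ae_restrict_iff' measurableSet_uIoc]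
  filter_upwards [h.ae_integrand_eq ha lam j] with t ht hmem
  exact (ht hmem).symm

end IsCutContour

end FinitePart

theorem theorem3p1 (k : ℂ → ℂ) (a : ℝ) (ha : 0 < a)
    (hk : AnalyticOnNhd ℂ k (Complex.ofReal '' Set.Icc 0 a))
    (lam : ℂ) (hre : 1 ≤ lam.re) (hlam : ∀ m : ℤ, lam ≠ m) (n : ℕ)
    (C : Path (a : ℂ) (a : ℂ)) (hC : FinitePart.IsCutContour k a C) :
    (∀ j ≤ n, FinitePart.ContourIntegrable
        (fun z => k z * FinitePart.cutPow z (-lam) * FinitePart.cutLog z ^ j) C) ∧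
    FinitePart.HasFinitePartIntegral
      (fun t : ℝ => k (t : ℂ) * (t : ℂ) ^ (-lam) * (Real.log t : ℂ) ^ n) a
      (∑ j ∈ Finset.range (n + 1),
        (n.choose j : ℂ) * (2 * Real.pi * Complex.I) ^ (n - j) * FinitePart.beta n j lam *
          FinitePart.contourIntegral
            (fun z => k z * FinitePart.cutPow z (-lam) * FinitePart.cutLog z ^ j) C) := by
  open FinitePart in
  refine ⟨fun j _ => hC.contourIntegrable ha lam j, ?_⟩
  set U : Set ℂ := {z | AnalyticAt ℂ k z} with hU
  have hUo : IsOpen U := isOpen_analyticAt ℂ k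
  have hkU : DifferentiableOn ℂ k U := fun z hz =>
    AnalyticAt.differentiableAt hz |>.differentiableWithinAt
  obtain ⟨δ, hδ, hΩU⟩ := (isCompact_Icc.image Complex.continuous_ofReal
    ).exists_thickening_subset_open hUo hk
  set Ω := Metric.thickening δ (Complex.ofReal '' Icc 0 a) with hΩ
  have hΩo : IsOpen Ω := Metric.isOpen_thickening
  have hΩc : Convex ℝ Ω :=
    ((convex_Icc (0 : ℝ) a).linear_image Complex.ofRealCLM.toLinearMap).thickening δ
  have haΩ : ∀ t ∈ Icc 0 a, (t : ℂ) ∈ Ω := fun t ht =>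
    Metric.self_subset_thickening hδ _ (mem_image_of_mem _ ht)
  have h0Ω : (0 : ℂ) ∈ Ω := by simpa using haΩ 0 (left_mem_Icc.2 ha.le)
  have hkΩ : DifferentiableOn ℂ k Ω := hkU.mono hΩU
  have hν : ∀ m : ℤ, (1 - lam) ≠ m := fun m e => hlam (1 - m) (by
    push_cast; linear_combination -e)
  obtain ⟨A, hA, hA0, hAs⟩ := exists_euler_seq hΩo hΩc h0Ω hν hkΩ
  have hfp := hasFinitePartIntegral_logPrimitive hΩo ha haΩ hν hkΩ hA hA0 hAs n
  rw [show (1 - lam) - 1 = -lam by ring] at hfp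
  have hloop := hC.cutLoop ha
  have hell := cutLoop_ellipse ha (show 0 < δ / 3 by positivity)
  have hellΩ : ∀ t, ellipse a (δ / 3) t ∈ Ω :=
    ellipse_mem_thickening ha (by positivity) (by linarith)
  -- each contour integral is the jump of a primitive
  have hI : ∀ j : ℕ, contourIntegral (fun z => k z * cutPow z (-lam) * cutLog z ^ j) C =
      logPrimitive (1 - lam) A j (Real.log a + 2 * Real.pi * Complex.I) -
        logPrimitive (1 - lam) A j (Real.log a) := by
    intro j
    have hψ : Differentiable ℂ fun u : ℂ => Complex.exp (-lam * u) * u ^ j := by fun_prop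
    rw [contourIntegral_eq_integral,
      intervalIntegral.integral_congr_ae (hC.ae_integrand_eq ha lam j)]
    rw [integral_eq_integral_of_winding_eq_zero hloop hell hUo hkU hC.mapsTo_analyticAt
      (fun t _ => hΩU (hellΩ t)) ?_ ?_ hψ]
    · have hmem : ∀ t ∈ Icc (0 : ℝ) 1,
          Complex.exp (logLift a (ellipse a (δ / 3)) t) ∈ Ω := fun t ht => by
        rw [hell.exp_logLift ht]; exact hellΩ t
      have hjump := hell.integral_logLift (G := logPrimitive (1 - lam) A j)
        (g := fun u => k (Complex.exp u) * Complex.exp ((1 - lam) * u) * u ^ j)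
        (fun t ht => hasDerivAt_logPrimitive hΩo hA hA0 hAs j (hmem t ht)) ?_
      · rw [← hjump]
        refine intervalIntegral.integral_congr fun t ht => ?_
        rw [uIcc_of_le zero_le_one] at ht
        have h1 := hell.exp_logLift ht
        have h2 := hell.ne_zero ht
        rw [show (1 - lam) * logLift a (ellipse a (δ / 3)) t =
          logLift a (ellipse a (δ / 3)) t + -lam * logLift a (ellipse a (δ / 3)) t by ring,
          Complex.exp_add, h1]
        field_simp
      · intro t ht
        have h1 := (hkΩ.differentiableAt (hΩo.mem_nhds (hmem t ht))).continuousAt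
        refine ContinuousAt.mul (ContinuousAt.mul ?_ (by fun_prop)) (by fun_prop)
        exact ContinuousAt.comp (f := Complex.exp) h1 Complex.continuous_exp.continuousAt
    · intro w hw
      have hw0 := hC.encloses_no_singularity w hw
      rw [windingNumber, mul_eq_zero, contourIntegral_eq_integral] at hw0
      exact hw0.resolve_left (inv_ne_zero Complex.two_pi_I_ne_zero)
    · intro w hw
      have hd : DifferentiableOn ℂ (fun z => (z - w)⁻¹) Ω := fun z hz =>
        ((differentiableAt_id.sub_const w).inv (sub_ne_zero.2 fun e =>
          hw (by rw [← show z = w from e]; exact hΩU hz))).differentiableWithinAt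
      obtain ⟨P, hP⟩ := hΩc.exists_forall_hasDerivWithinAt hd
      exact hell.integral_eq_zero (G := P) (g := fun z => (z - w)⁻¹)
        (fun t _ => (hP _ (hellΩ t)).hasDerivAt (hΩo.mem_nhds (hellΩ t)))
        (fun t _ => (hd.differentiableAt (hΩo.mem_nhds (hellΩ t))).continuousAt)
  have hq : Complex.exp ((1 - lam) * (2 * Real.pi * Complex.I)) =
      Complex.exp (-2 * Real.pi * Complex.I * lam) := by
    rw [show (1 - lam) * (2 * Real.pi * Complex.I) =
      2 * Real.pi * Complex.I + -2 * Real.pi * Complex.I * lam by ring, Complex.exp_add,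
      Complex.exp_two_pi_mul_I, one_mul]
  have hjumps := egf_logPrimitive_sub (1 - lam) A (Real.log a)
  rw [hq] at hjumps
  have hfinal := sum_choose_mul_invExpCoeff (exp_neg_two_pi_I_mul_ne_one hlam) _ hjumps n
  rw [← hfinal] at hfp
  simpa only [hI, beta_eq_invExpCoeff] using hfp
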